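/- Let $M$ be a smooth (Hausdorff, finite-dimensional) manifold with projection $\pi:TM\to M$, and let $A\subset TM$ be open and conic ($\lambda v\in A$ for all $v\in A$, $\lambda>0$) with $\pi(A)=M$. All objects below are $C^\infty$. An $A$-anisotropic tensor field $T\in\mathcal T^r_s(M_A)$ assigns smoothly to each $v\in A$ an $(r,s)$-tensor $T_v$ on $T_{\pi(v)}M$, viewed as a multilinear function of $r$ covectors and $s$ vectors. An $A$-anisotropic connection is a map $\nabla:\mathfrak X(M)\times\mathfrak X(M)\to\mathcal T^1_0(M_A)$ that is additive in the second variable, satisfies $\nabla_X(fY)=(X(f)\,Y)\circ\pi+(f\circ\pi)\nabla_XY$, and is $C^\infty(M)$-linear in the first variable. Its Christoffel symbols in coordinates $x^i$ are given by $(\nabla_{\partial_i}\partial_j)_v=\Gamma^k_{ij}(v)\,\partial_k$. With $(x,y)$ the induced coordinates on $TM$, the covariant derivative of $T$ at $v\in A$ in the direction $u=u^k\partial_k\in T_{\pi(v)}M$ is the tensor $(\nabla_uT)_v$ on $T_{\pi(v)}M$ with components $$u^k\Big(\partial_{x^k}T^{a_1\dots a_r}_{b_1\dots b_s}-\Gamma^i_{kj}y^j\,\partial_{y^i}T^{a_1\dots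 a_r}_{b_1\dots b_s}+\sum_{l=1}^r\Gamma^{a_l}_{kj}T^{a_1\dots j\dots a_r}_{b_1\dots b_s}-\sum_{l=1}^s\Gamma^{i}_{kb_l}T^{a_1\dots a_r}_{b_1\dots i\dots b_s}\Big)(v).$$ Let $\gamma:[a,b]\to M$, $a<b$, be a regular curve (smooth with $\dot\gamma\neq0$ everywhere). For a field $W$ along $\gamma$ with values in $A$, the covariant derivative of a field $X$ along $\gamma$ with reference $W$ is $D^W_\gamma X=(\dot X^i+\Gamma^i_{jk}(W)\,\dot\gamma^jX^k)\,\partial_i$. For $v\in A\cap T_{\gamma(t_1)}M$ let $V$ be the $A$-valued field along $\gamma$ with $D^V_\gamma V=0$, $V(t_1)=v$; where it is defined, put $P_{t_1,t_2}(v)=V(t_2)$, and let $P^v_{t_1,t_2}:T_{\gamma(t_1)}M\to T_{\gamma(t_2)}M$ send $w$ to $Z(t_2)$, where $D^V_\gamma Z=0$ and $Z(t_1)=w$. Covectors are transported by $P^v_{t_1,t_2}(\theta)=\theta\circ P^{P_{t_1,t_2}(v)}_{t_2,t_1}$. For $v\in A\cap T_{\gamma(a)}M$ and $t\ge a$ close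 to $a$, let $P_t(T)_v$ be the $(r,s)$-tensor on $T_{\gamma(a)}M$ $$P_t(T)_v(\theta^1,\dots,\theta^r,w_1,\dots,w_s)=T_{P_{a,t}(v)}\big(P^v_{a,t}(\theta^1),\dots,P^v_{a,t}(\theta^r),P^v_{a,t}(w_1),\dots,P^v_{a,t}(w_s)\big).$$ Then for every $A$-anisotropic tensor field $T\in\mathcal T^r_s(M_A)$, every $A$-anisotropic connection $\nabla$, every regular curve $\gamma:[a,b]\to M$ and every $v\in A\cap T_{\gamma(a)}M$, the curve $t\mapsto P_t(T)_v$ in the vector space of $(r,s)$-tensors on $T_{\gamma(a)}M$ is (one-sidedly) differentiable at $t=a$ and $$(\nabla_{\dot\gamma(a)}T)_v=\frac{d}{dt}P_t(T)_v\Big|_{t=a}.$$ -/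

import Mathlib

open Set Bundle
open scoped Manifold ContDiff Topology

noncomputable section

/-! ### Tensors of type `(r, s)` on a real topological vector space -/

/-- The argument slots of an `(r, s)`-tensor on `F`: `r` covectors followed by `s` vectors. -/
def TensorSlot (F : Type*) [AddCommGroup F] [Module ℝ F] [TopologicalSpace F] (r s : ℕ) :
    Fin r ⊕ Fin s → Type _
  | Sum.inl _ => F →L[ℝ] ℝ
  | Sum.inr _ => F

section Tensor

variable {F G : Type*}
  [AddCommGroup F] [Module ℝ F] [TopologicalSpace F]
  [AddCommGroup G] [Module ℝ G] [TopologicalSpace G]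
  {r s : ℕ}

instance TensorSlot.instAddCommGroup : ∀ i, AddCommGroup (TensorSlot F r s i)
  | Sum.inl _ => inferInstanceAs (AddCommGroup (F →L[ℝ] ℝ))
  | Sum.inr _ => inferInstanceAs (AddCommGroup F)

instance TensorSlot.instModule : ∀ i, Module ℝ (TensorSlot F r s i)
  | Sum.inl _ => inferInstanceAs (Module ℝ (F →L[ℝ] ℝ))
  | Sum.inr _ => inferInstanceAs (Module ℝ F)

instance TensorSlot.instTopologicalSpace : ∀ i, TopologicalSpace (TensorSlot F r s i)
  | Sum.inl _ => inferInstanceAs (TopologicalSpace (F →L[ℝ] ℝ))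
  | Sum.inr _ => inferInstanceAs (TopologicalSpace F)

instance TensorSlot.instContinuousSMul [ContinuousSMul ℝ F] :
    ∀ i, ContinuousSMul ℝ (TensorSlot F r s i)
  | Sum.inl _ => inferInstanceAs (ContinuousSMul ℝ (F →L[ℝ] ℝ))
  | Sum.inr _ => inferInstanceAs (ContinuousSMul ℝ F)

variable (F r s) in
/-- Tensors of type `(r, s)` on `F`: real multilinear functions of `r` covectors and `s` vectors. -/
abbrev Tensor : Type _ := ContinuousMultilinearMap ℝ (TensorSlot F r s) ℝ

/-- The maps induced on the slots by `f : F → G` (acting on vectors) and `g : G → F` (acting on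
covectors by precomposition). -/
def slotMap (f : F →L[ℝ] G) (g : G →L[ℝ] F) :
    ∀ i : Fin r ⊕ Fin s, TensorSlot F r s i →L[ℝ] TensorSlot G r s i
  | Sum.inl _ => ContinuousLinearMap.precomp ℝ g
  | Sum.inr _ => f

/-- The tensor `(θ¹, …, θʳ, w₁, …, wₛ) ↦ T (θ¹ ∘ g, …, θʳ ∘ g, f w₁, …, f wₛ)`. -/
def Tensor.pull (f : F →L[ℝ] G) (g : G →L[ℝ] F) (T : Tensor G r s) : Tensor F r s :=
  ContinuousMultilinearMap.compContinuousLinearMap T (slotMap f g)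

/-- The action of an endomorphism `L` on the slots as a derivation commuting with contractions:
`w ↦ L w` on vectors and `θ ↦ -θ ∘ L` on covectors. -/
def slotDerivation [IsTopologicalAddGroup F] (L : F →L[ℝ] F) :
    ∀ i : Fin r ⊕ Fin s, TensorSlot F r s i →L[ℝ] TensorSlot F r s i
  | Sum.inl _ => -(ContinuousLinearMap.precomp ℝ L : (F →L[ℝ] ℝ) →L[ℝ] (F →L[ℝ] ℝ))
  | Sum.inr _ => L

/-- `∑ₖ T (θ¹, …, -θᵏ ∘ L, …, wₛ) + ∑ₗ T (θ¹, …, L wₗ, …, wₛ)`. -/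
def Tensor.derivationTerm [IsTopologicalAddGroup F] (L : F →L[ℝ] F) (T : Tensor F r s) :
    Tensor F r s :=
  ∑ i, ContinuousMultilinearMap.compContinuousLinearMap T
    (Function.update (fun j => ContinuousLinearMap.id ℝ (TensorSlot F r s j)) i
      (slotDerivation L i))

end Tensor

section Manifold

variable {E : Type*} [NormedAddCommGroup E] [NormedSpace ℝ E]
  {M : Type*} [TopologicalSpace M] [ChartedSpace E M]

/-! ### Vector fields -/

variable (E M) in
/-- `𝔛(M)`: smooth vector fields on `M`. -/
abbrev VField [IsManifold 𝓘(ℝ, E) ∞ M] : Type _ :=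
  ContMDiffSection 𝓘(ℝ, E) E ∞ (TangentSpace 𝓘(ℝ, E) : M → Type _)

/-- The product of a smooth function and a smooth vector field. -/
def VField.mulFun [IsManifold 𝓘(ℝ, E) ∞ M] (f : C^∞⟮𝓘(ℝ, E), M; ℝ⟯) (X : VField E M) :
    VField E M :=
  ⟨fun p => f p • X p, f.contMDiff.smul_section X.contMDiff⟩

/-- The derivative `X_p(f)` of a smooth function `f` in the direction of the vector `X_p`. -/
def dirDeriv (f : C^∞⟮𝓘(ℝ, E), M; ℝ⟯) {p : M} (u : TangentSpace 𝓘(ℝ, E) p) : ℝ :=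
  NormedSpace.fromTangentSpace (f p) (mfderiv 𝓘(ℝ, E) 𝓘(ℝ) f p u)

lemma dirDeriv_const (c : ℝ) {p : M} (u : TangentSpace 𝓘(ℝ, E) p) :
    dirDeriv (ContMDiffMap.const c) u = 0 := by
  have h : mfderiv 𝓘(ℝ, E) 𝓘(ℝ) (ContMDiffMap.const c : C^∞⟮𝓘(ℝ, E), M; ℝ⟯) p = 0 :=
    mfderiv_const
  rw [dirDeriv, h]
  exact map_zero (NormedSpace.fromTangentSpace (𝕜 := ℝ) (E := ℝ) _)

variable [IsManifold 𝓘(ℝ, E) ∞ M]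

/-- The vector at `q` with the same natural coordinates around `p` as `w ∈ T_p M`. -/
def constField {p : M} (w : TangentSpace 𝓘(ℝ, E) p) (q : M) : TangentSpace 𝓘(ℝ, E) q :=
  (trivializationAt E (TangentSpace 𝓘(ℝ, E)) p).symmL ℝ q
    ((trivializationAt E (TangentSpace 𝓘(ℝ, E)) p).continuousLinearMapAt ℝ p w)

lemma contMDiffOn_constField {p : M} (w : TangentSpace 𝓘(ℝ, E) p) :
    ContMDiffOn 𝓘(ℝ, E) 𝓘(ℝ, E).tangent ∞
      (fun q => (⟨q, constField w q⟩ : TangentBundle 𝓘(ℝ, E) M)) (chartAt E p).source := by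
  have key : ∀ y ∈ (chartAt E p).source,
      (trivializationAt E (TangentSpace 𝓘(ℝ, E)) p ⟨y, constField w y⟩).2 =
        (trivializationAt E (TangentSpace 𝓘(ℝ, E)) p).continuousLinearMapAt ℝ p w := by
    intro y hy
    have hy' : y ∈ (trivializationAt E (TangentSpace 𝓘(ℝ, E)) p).baseSet := hy
    rw [constField, Bundle.Trivialization.symmL_apply, Bundle.Trivialization.apply_mk_symm]
    all_goals exact hy'
  intro x hx
  have hx' : x ∈ (trivializationAt E (TangentSpace 𝓘(ℝ, E)) p).baseSet := hx
  exact ((trivializationAt E (TangentSpace 𝓘(ℝ, E)) p).contMDiffWithinAt_section _ hx').2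
    (contMDiffWithinAt_const.congr key (key x hx))

variable [FiniteDimensional ℝ E] [T2Space M]

/-- A smooth vector field on `M` which near `p` is the field with constant coefficients, in the
natural coordinates around `p`, whose value at `p` is `w` (it is cut off by a bump function). -/
def coordExt {p : M} (w : TangentSpace 𝓘(ℝ, E) p) : VField E M :=
  ⟨(Classical.arbitrary (SmoothBumpFunction 𝓘(ℝ, E) p) : M → ℝ) • constField w,
    ContMDiffOn.smul_section_of_tsupport
      (SmoothBumpFunction.contMDiff _).contMDiffOn (chartAt E p).open_source
      (SmoothBumpFunction.tsupport_subset_chartAt_source _) (contMDiffOn_constField w)⟩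

lemma coordExt_add {p : M} (w w' : TangentSpace 𝓘(ℝ, E) p) :
    coordExt (w + w') = coordExt w + coordExt w' := by
  ext q
  change (Classical.arbitrary (SmoothBumpFunction 𝓘(ℝ, E) p) q : ℝ) • constField (w + w') q =
    (Classical.arbitrary (SmoothBumpFunction 𝓘(ℝ, E) p) q : ℝ) • constField w q +
    (Classical.arbitrary (SmoothBumpFunction 𝓘(ℝ, E) p) q : ℝ) • constField w' q
  simp only [constField, map_add, smul_add]

lemma coordExt_smul {p : M} (c : ℝ) (w : TangentSpace 𝓘(ℝ, E) p) :
    coordExt (c • w) = VField.mulFun (ContMDiffMap.const c) (coordExt w) := by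
  ext q
  change (Classical.arbitrary (SmoothBumpFunction 𝓘(ℝ, E) p) q : ℝ) • constField (c • w) q =
    c • ((Classical.arbitrary (SmoothBumpFunction 𝓘(ℝ, E) p) q : ℝ) • constField w q)
  simp only [constField, map_smul]
  rw [smul_comm]

/-! ### Anisotropic tensor fields and anisotropic connections

`A` is a subset of `TM`. Objects over `A` are functions on `TM` of which only the values on `A`
matter. -/

/-- The coordinate representation of a tensor at `q` in the natural coordinates around `x`. -/
def Tensor.inChart {r s : ℕ} (x : M) {q : M} (T : Tensor (TangentSpace 𝓘(ℝ, E) q) r s) :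
    Tensor E r s :=
  T.pull ((trivializationAt E (TangentSpace 𝓘(ℝ, E)) x).symmL ℝ q)
    ((trivializationAt E (TangentSpace 𝓘(ℝ, E)) x).continuousLinearMapAt ℝ q)

/-- An `A`-anisotropic tensor field of type `(r, s)`: a tensor on `T_{π(v)}M` for each `v ∈ A`,
whose components in natural coordinates are smooth functions of `v`. -/
structure AnisotropicTensor (A : Set (TangentBundle 𝓘(ℝ, E) M)) (r s : ℕ) where
  toFun : ∀ v : TangentBundle 𝓘(ℝ, E) M, Tensor (TangentSpace 𝓘(ℝ, E) v.proj) r s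
  smooth : ∀ (x : M) (m : ∀ i, TensorSlot E r s i),
    ContMDiffOn 𝓘(ℝ, E).tangent 𝓘(ℝ) ∞ (fun v => (toFun v).inChart x m)
      (A ∩ {v | v.proj ∈ (chartAt E x).source})

/-- An `A`-anisotropic connection `(X, Y) ↦ ∇_X Y`; here `∇.toFun X Y v` is `(∇_X Y)_v`. -/
structure AnisotropicConnection (A : Set (TangentBundle 𝓘(ℝ, E) M)) where
  toFun : VField E M → VField E M → ∀ v : TangentBundle 𝓘(ℝ, E) M, TangentSpace 𝓘(ℝ, E) v.proj
  smooth : ∀ X Y : VField E M, ContMDiffOn 𝓘(ℝ, E).tangent 𝓘(ℝ, E).tangent ∞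
    (fun v => (⟨v.proj, toFun X Y v⟩ : TangentBundle 𝓘(ℝ, E) M)) A
  add_right : ∀ X Y Z : VField E M, ∀ v ∈ A, toFun X (Y + Z) v = toFun X Y v + toFun X Z v
  leibniz : ∀ (f : C^∞⟮𝓘(ℝ, E), M; ℝ⟯) (X Y : VField E M), ∀ v ∈ A,
    toFun X (VField.mulFun f Y) v =
      dirDeriv f (X v.proj) • Y v.proj + f v.proj • toFun X Y v
  linear_left : ∀ (f h : C^∞⟮𝓘(ℝ, E), M; ℝ⟯) (X Y Z : VField E M), ∀ v ∈ A,
    toFun (VField.mulFun f X + VField.mulFun h Y) Z v =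
      f v.proj • toFun X Z v + h v.proj • toFun Y Z v

namespace AnisotropicConnection

variable {A : Set (TangentBundle 𝓘(ℝ, E) M)} (nabla : AnisotropicConnection A)

/-- The Christoffel symbols at `v ∈ T_p M` in the natural coordinates around `p`, as the bilinear
expression `uⁱ wʲ Γᵏᵢⱼ(v) ∂ₖ`, that is, `∇` of coordinate fields with constant coefficients. -/
def christoffel {p : M} (v u w : TangentSpace 𝓘(ℝ, E) p) : TangentSpace 𝓘(ℝ, E) p :=
  nabla.toFun (coordExt u) (coordExt w) ⟨p, v⟩

/-- `w ↦ Γ_v(u, w)` as a linear map. -/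
def christoffelMap {p : M} (v : TangentSpace 𝓘(ℝ, E) p)
    (hv : (⟨p, v⟩ : TangentBundle 𝓘(ℝ, E) M) ∈ A) (u : TangentSpace 𝓘(ℝ, E) p) :
    TangentSpace 𝓘(ℝ, E) p →L[ℝ] TangentSpace 𝓘(ℝ, E) p :=
  haveI : FiniteDimensional ℝ (TangentSpace 𝓘(ℝ, E) p) := inferInstanceAs (FiniteDimensional ℝ E)
  haveI : T2Space (TangentSpace 𝓘(ℝ, E) p) := inferInstanceAs (T2Space E)
  LinearMap.toContinuousLinearMap
    { toFun := fun w => nabla.christoffel v u w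
      map_add' := fun w w' => by
        simp only [christoffel, coordExt_add, nabla.add_right _ _ _ _ hv]
      map_smul' := fun c w => by
        simp only [christoffel, coordExt_smul, nabla.leibniz _ _ _ _ hv, RingHom.id_apply]
        rw [dirDeriv_const, zero_smul, zero_add]
        rfl }

/-! ### Covariant derivative of anisotropic tensors -/

/-- The point with coordinates `x(p) + τ u` in the chart around `p`. -/
def chartLine {p : M} (u : TangentSpace 𝓘(ℝ, E) p) (τ : ℝ) : M :=
  (extChartAt 𝓘(ℝ, E) p).symm (extChartAt 𝓘(ℝ, E) p p +
    τ • (trivializationAt E (TangentSpace 𝓘(ℝ, E)) p).continuousLinearMapAt ℝ p u)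

/-- The covariant derivative `(∇_u T)_v`, `v ∈ A ∩ T_p M`, `u ∈ T_p M`. In the natural coordinates
`(x, y)` around `p` its components are
`uᵏ (∂_{xᵏ} T - Γⁱₖⱼ yʲ ∂_{yⁱ} T + ∑ Γ^{a_l}ₖⱼ T^{… j …} - ∑ Γⁱ_{k b_l} T_{… i …})`,
all evaluated at `v`. -/
def covDeriv {r s : ℕ} (T : AnisotropicTensor A r s) {p : M} (v : TangentSpace 𝓘(ℝ, E) p)
    (hv : (⟨p, v⟩ : TangentBundle 𝓘(ℝ, E) M) ∈ A) (u : TangentSpace 𝓘(ℝ, E) p) :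
    Tensor (TangentSpace 𝓘(ℝ, E) p) r s :=
  -- horizontal part: derivative of the components at `(x(p) + τ u, y(v))`
  Tensor.pull ((trivializationAt E (TangentSpace 𝓘(ℝ, E)) p).continuousLinearMapAt ℝ p)
      ((trivializationAt E (TangentSpace 𝓘(ℝ, E)) p).symmL ℝ p)
      (deriv (fun τ : ℝ =>
        (T.toFun ⟨chartLine u τ, constField v (chartLine u τ)⟩).inChart p) 0)
    -- vertical derivative in the direction `Γ_v(u, v)`
    - deriv (fun τ : ℝ => T.toFun ⟨p, v + τ • nabla.christoffel v u v⟩) 0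
    - (T.toFun ⟨p, v⟩).derivationTerm (nabla.christoffelMap v hv u)

/-! ### Covariant derivative and parallel transport along a curve `γ : [a, b] → M` -/

variable (E) in
/-- The velocity of `γ : [a, b] → M` (one-sided at the ends). -/
def velocity (γ : ℝ → M) (a b t : ℝ) : TangentSpace 𝓘(ℝ, E) (γ t) :=
  mfderivWithin 𝓘(ℝ) 𝓘(ℝ, E) γ (Icc a b) t (1 : ℝ)

/-- The covariant derivative `D_γ^v X` at the instant `t` of a field `X` along `γ : [a, b] → M`,
with reference vector `v ∈ T_{γ(t)} M`: in the natural coordinates around `γ(t)` it is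
`(Ẋⁱ + Γⁱⱼₖ(v) γ̇ʲ Xᵏ) ∂ᵢ`. -/
def covDerivAlong (γ : ℝ → M) (a b : ℝ) (X : ∀ t, TangentSpace 𝓘(ℝ, E) (γ t)) (t : ℝ)
    (v : TangentSpace 𝓘(ℝ, E) (γ t)) : TangentSpace 𝓘(ℝ, E) (γ t) :=
  (trivializationAt E (TangentSpace 𝓘(ℝ, E)) (γ t)).symmL ℝ (γ t)
      (derivWithin
        (fun τ => (trivializationAt E (TangentSpace 𝓘(ℝ, E)) (γ t) ⟨γ τ, X τ⟩).2) (Icc a b) t)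
    + nabla.christoffel v (velocity E γ a b t) (X t)

/-- `X` is smooth and `D_γ^W X = 0` on the subset `J` of `[a, b]`. -/
structure IsParallelOn (γ : ℝ → M) (a b : ℝ) (J : Set ℝ)
    (W X : ∀ t, TangentSpace 𝓘(ℝ, E) (γ t)) : Prop where
  smooth : ContMDiffOn 𝓘(ℝ) 𝓘(ℝ, E).tangent ∞
    (fun t => (⟨γ t, X t⟩ : TangentBundle 𝓘(ℝ, E) M)) J
  parallel : ∀ t ∈ J, nabla.covDerivAlong γ a b X t (W t) = 0

/-- `V` is an `A`-admissible field with `D_γ^V V = 0` on `J`. -/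
structure IsParallelObserverOn (γ : ℝ → M) (a b : ℝ) (J : Set ℝ)
    (V : ∀ t, TangentSpace 𝓘(ℝ, E) (γ t)) : Prop where
  admissible : ∀ t ∈ J, (⟨γ t, V t⟩ : TangentBundle 𝓘(ℝ, E) M) ∈ A
  parallel : nabla.IsParallelOn γ a b J V V

/-- `J` is a relatively open subinterval of `[a, b]` containing `t₁` and `t₂`. -/
structure IsTransportInterval (a b : ℝ) (J : Set ℝ) (t₁ t₂ : ℝ) : Prop where
  subset : J ⊆ Icc a b
  ordConnected : J.OrdConnected
  mem_nhdsWithin : ∀ t ∈ J, J ∈ 𝓝[Icc a b] t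
  left_mem : t₁ ∈ J
  right_mem : t₂ ∈ J

open Classical in
/-- The instantaneous observer's parallel transport `P_{t₁,t₂}(v) = V(t₂)`, where `V(t₁) = v` and
`D_γ^V V = 0` (zero if there is no such `V` between `t₁` and `t₂`). -/
def observerTransport (γ : ℝ → M) (a b t₁ t₂ : ℝ) (v : TangentSpace 𝓘(ℝ, E) (γ t₁)) :
    TangentSpace 𝓘(ℝ, E) (γ t₂) :=
  if h : ∃ V : ∀ t, TangentSpace 𝓘(ℝ, E) (γ t), V t₁ = v ∧
      ∃ J, IsTransportInterval a b J t₁ t₂ ∧ nabla.IsParallelObserverOn γ a b J V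
  then h.choose t₂ else 0

/-- `W` is a field along `γ` from `t₁` to `t₂` with `D_γ^V W = 0`, where `V` is the parallel observer
with `V(t₁) = v`. -/
def IsParallelWrtObserver (γ : ℝ → M) (a b t₁ t₂ : ℝ) (v : TangentSpace 𝓘(ℝ, E) (γ t₁))
    (W : ∀ t, TangentSpace 𝓘(ℝ, E) (γ t)) : Prop :=
  ∃ (J : Set ℝ) (V : ∀ t, TangentSpace 𝓘(ℝ, E) (γ t)), IsTransportInterval a b J t₁ t₂ ∧
    V t₁ = v ∧ nabla.IsParallelObserverOn γ a b J V ∧ nabla.IsParallelOn γ a b J V W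

open Classical in
/-- The parallel transport `P^v_{t₁,t₂}` with respect to the observer `v`: the linear map sending
each `w` to `W(t₂)`, where `W(t₁) = w`, `D_γ^V W = 0` and `V` is the parallel observer with
`V(t₁) = v` (zero if `V` does not reach `t₂`). -/
def transport (γ : ℝ → M) (a b t₁ t₂ : ℝ) (v : TangentSpace 𝓘(ℝ, E) (γ t₁)) :
    TangentSpace 𝓘(ℝ, E) (γ t₁) →L[ℝ] TangentSpace 𝓘(ℝ, E) (γ t₂) :=
  if h : ∃ L : TangentSpace 𝓘(ℝ, E) (γ t₁) →L[ℝ] TangentSpace 𝓘(ℝ, E) (γ t₂),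
      ∀ w, ∃ W : ∀ t, TangentSpace 𝓘(ℝ, E) (γ t),
        nabla.IsParallelWrtObserver γ a b t₁ t₂ v W ∧ W t₁ = w ∧ W t₂ = L w
  then h.choose else 0

/-- The parallel transport of an anisotropic tensor,
`P_{t₁,t₂}(T)_v (θ, …, w, …) = T_{P_{t₂,t₁}(v)} (P^v_{t₂,t₁} θ, …, P^v_{t₂,t₁} w, …)` for
`v ∈ T_{γ(t₂)} M`. A covector `θ` at `γ(t₂)` is transported to `γ(t₁)` as `θ` composed with the
transport of vectors from `γ(t₁)` back to `γ(t₂)` with respect to the same parallel observer. -/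
def tensorTransport {r s : ℕ} (T : AnisotropicTensor A r s) (γ : ℝ → M) (a b t₁ t₂ : ℝ)
    (v : TangentSpace 𝓘(ℝ, E) (γ t₂)) : Tensor (TangentSpace 𝓘(ℝ, E) (γ t₂)) r s :=
  Tensor.pull (nabla.transport γ a b t₂ t₁ v)
    (nabla.transport γ a b t₁ t₂ (nabla.observerTransport γ a b t₂ t₁ v))
    (T.toFun ⟨γ t₁, nabla.observerTransport γ a b t₂ t₁ v⟩)

end AnisotropicConnection

end Manifold

end

/-!
In the natural coordinates `(x, y)` around `γ a`, the parallel observer along `γ` solves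
`ẏ = -Γ(x, y)(ẋ, y)`, and the parallel transport with respect to it is a curve `Φ` of endomorphisms
with `Φ̇ = -Γ(x, y)(ẋ, Φ)` and `Φ(a) = 1`. Hence for `t` near `a` the coordinates of `P_t(T)_v` are
those of `T` at `(x(t), Φ(t) y(a))`, pulled back by `Φ(t)` and `Φ(t)⁻¹`; the product rule at `t = a`
gives the coordinate formula for `∇T`, whose `y`-derivative term is the change of the observer and
whose tensorial terms are the derivative of `Φ`.

Since `D_γ` is defined with the natural coordinates around `γ t`, different for each `t`, the
equations in the fixed coordinates around `γ a` depend on the locality and the Leibniz rule of `∇`.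
Uniqueness for the differential equations identifies the transports, which are chosen among all
parallel fields, with those given by `Φ`.
-/

noncomputable section

section TopologicalVectorSpace

variable {𝕜 V W : Type*} [NontriviallyNormedField 𝕜]
  [AddCommGroup V] [Module 𝕜 V] [TopologicalSpace V] [ContinuousSMul 𝕜 V]
  [AddCommGroup W] [Module 𝕜 W] [TopologicalSpace W] [ContinuousSMul 𝕜 W]
  {f : 𝕜 → V} {f' : V} {l : Filter (𝕜 × 𝕜)}

lemma hasDerivAtFilter_clm_comp (L : V →L[𝕜] W) (h : HasDerivAtFilter f f' l) :
    HasDerivAtFilter (fun t => L (f t)) (L f') l := by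
  refine (hasFDerivAtFilter_iff_isLittleOTVS _ _ _).2 <| ((L.isBigOTVS_comp
    (f := fun p : 𝕜 × 𝕜 => f p.1 - f p.2 -
      ContinuousLinearMap.toSpanSingleton 𝕜 f' (p.1 - p.2))).trans_isLittleOTVS
    ((hasFDerivAtFilter_iff_isLittleOTVS _ _ _).1 h)).congr_left fun p => ?_
  simp

lemma hasDerivAtFilter_clm_comp_iff {L : V →L[𝕜] W} (hL : Topology.IsInducing L) :
    HasDerivAtFilter (fun t => L (f t)) (L f') l ↔ HasDerivAtFilter f f' l := by
  refine ⟨fun h => ?_, hasDerivAtFilter_clm_comp L⟩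
  have hΘ := L.isThetaTVS_comp (l := l) (f := fun p : 𝕜 × 𝕜 => f p.1 - f p.2 -
    ContinuousLinearMap.toSpanSingleton 𝕜 f' (p.1 - p.2)) hL
  refine (hasFDerivAtFilter_iff_isLittleOTVS _ _ _).2 <| hΘ.symm.trans_isLittleOTVS <|
    ((hasFDerivAtFilter_iff_isLittleOTVS _ _ _).1 h).congr_left fun p => ?_
  simp

lemma deriv_eq_of_hasDerivAt [ContinuousAdd V] [T2Space V] {t : 𝕜} (h : HasDerivAt f f' t) :
    deriv f t = f' := by
  have hf : fderiv 𝕜 f t = ContinuousLinearMap.toSpanSingleton 𝕜 f' :=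
    (HasFDerivAt.differentiableAt (h := h)).hasFDerivAt.unique h
  simp [deriv, hf]

lemma hasDerivAtFilter_pi_tvs {ι : Type*} {V : ι → Type*} [∀ i, AddCommGroup (V i)]
    [∀ i, Module 𝕜 (V i)] [∀ i, TopologicalSpace (V i)] [∀ i, ContinuousSMul 𝕜 (V i)]
    {f : 𝕜 → ∀ i, V i} {f' : ∀ i, V i} :
    HasDerivAtFilter f f' l ↔ ∀ i, HasDerivAtFilter (fun t => f t i) (f' i) l :=
  ⟨fun h i => hasDerivAtFilter_clm_comp (ContinuousLinearMap.proj i) h, fun h =>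
    (hasFDerivAtFilter_iff_isLittleOTVS _ _ _).2 <| Asymptotics.IsLittleOTVS.pi fun i =>
      (hasFDerivAtFilter_iff_isLittleOTVS _ _ _).1 (h i)⟩

end TopologicalVectorSpace

section ContinuousMultilinearMap

variable {ι : Type*} {V : ι → Type*} {W : Type*}
  [∀ i, AddCommGroup (V i)] [∀ i, Module ℝ (V i)] [∀ i, TopologicalSpace (V i)]
  [∀ i, ContinuousSMul ℝ (V i)] [NormedAddCommGroup W] [NormedSpace ℝ W]

variable (V W) in
/-- A multilinear map as the family of its values, which are its components; it is used to
differentiate curves of multilinear maps between spaces without a preferred norm. -/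
def multilinearComponents : ContinuousMultilinearMap ℝ V W →L[ℝ] (∀ i, V i) → W :=
  ContinuousLinearMap.pi (ContinuousMultilinearMap.apply ℝ V W)

section Components

variable [Finite ι] [∀ i, Module.Finite ℝ (V i)] [FiniteDimensional ℝ W]

lemma isClosedEmbedding_multilinearComponents :
    Topology.IsClosedEmbedding (multilinearComponents V W) := by
  have : Module.Finite ℝ (ContinuousMultilinearMap ℝ V W) := Module.Finite.of_injective
    (ContinuousMultilinearMap.toMultilinearMapLinear :
      ContinuousMultilinearMap ℝ V W →ₗ[ℝ] MultilinearMap ℝ V W)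
    ContinuousMultilinearMap.toMultilinearMap_injective
  refine LinearMap.isClosedEmbedding_of_injective (f := (multilinearComponents V W).toLinearMap) ?_
  exact LinearMap.ker_eq_bot.2 fun T T' h => ContinuousMultilinearMap.ext fun m => congrFun h m

variable {T : ℝ → ContinuousMultilinearMap ℝ V W}

lemma hasDerivAtFilter_multilinear_iff {T' : ContinuousMultilinearMap ℝ V W} {l : Filter (ℝ × ℝ)} :
    HasDerivAtFilter T T' l ↔ ∀ m, HasDerivAtFilter (fun t => T t m) (T' m) l :=
  (hasDerivAtFilter_clm_comp_iff isClosedEmbedding_multilinearComponents.isInducing).symm.trans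
    hasDerivAtFilter_pi_tvs

lemma deriv_multilinear_apply {t : ℝ} {φ : (∀ i, V i) → W}
    (h : ∀ m, HasDerivAt (fun τ => T τ m) (φ m) t) (m : ∀ i, V i) : deriv T t m = φ m := by
  obtain ⟨T', hT'⟩ : φ ∈ range (multilinearComponents V W) := by
    refine isClosedEmbedding_multilinearComponents.isClosed_range.mem_of_tendsto
      (b := 𝓝[≠] t) (f := fun τ => multilinearComponents V W ((τ - t)⁻¹ • (T τ - T t)))
      (tendsto_pi_nhds.2 fun m => ?_) (Filter.Eventually.of_forall fun τ => mem_range_self _)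
    exact hasDerivAt_iff_tendsto_slope.1 (h m)
  have hT : HasDerivAt T T' t := hasDerivAtFilter_multilinear_iff.2 (by rw [← hT'] at h; exact h)
  rw [deriv_eq_of_hasDerivAt hT, ← hT']
  rfl

end Components

lemma hasDerivWithinAt_multilinear_apply [Fintype ι] [DecidableEq ι]
    [∀ i, FiniteDimensional ℝ (V i)] [∀ i, IsTopologicalAddGroup (V i)] [∀ i, T2Space (V i)]
    {T : ℝ → ContinuousMultilinearMap ℝ V W} {T' : ContinuousMultilinearMap ℝ V W}
    {m : ℝ → ∀ i, V i} {m' : ∀ i, V i} {S : Set ℝ} {t : ℝ}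
    (hT : HasDerivWithinAt T T' S t) (hm : ∀ i, HasDerivWithinAt (fun τ => m τ i) (m' i) S t) :
    HasDerivWithinAt (fun τ => T τ (m τ))
      (T' (m t) + ∑ i, T t (Function.update (m t) i (m' i))) S t := by
  let K (i : ι) := EuclideanSpace ℝ (Fin (Module.finrank ℝ (V i)))
  let e (i : ι) : V i ≃L[ℝ] K i := toEuclidean
  let L : ContinuousMultilinearMap ℝ V W →L[ℝ] ContinuousMultilinearMap ℝ K W :=
    ContinuousMultilinearMap.compContinuousLinearMapL fun i => ((e i).symm : K i →L[ℝ] V i)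
  have hL (U : ContinuousMultilinearMap ℝ V W) (k : ∀ i, V i) : L U (fun i => e i (k i)) = U k := by
    simp [L]
  have hupd (i : ι) : Function.update (fun j => e j (m t j)) i (e i (m' i)) =
      fun j => e j (Function.update (m t) i (m' i) j) := by
    ext1 j
    rcases eq_or_ne j i with rfl | hij <;> simp [*]
  have hLT : HasDerivWithinAt (fun τ => L (T τ)) (L T') S t := hasDerivAtFilter_clm_comp L hT
  have hem (i : ι) : HasDerivWithinAt (fun τ => e i (m τ i)) (e i (m' i)) S t :=
    hasDerivAtFilter_clm_comp (e i : V i →L[ℝ] K i) (hm i)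
  have h := (hLT.hasFDerivWithinAt.continuousMultilinearMap_apply
    fun i => (hem i).hasFDerivWithinAt).hasDerivWithinAt
  simp only [hL] at h
  refine h.congr_deriv ?_
  simp [hL, hupd]

end ContinuousMultilinearMap

section Tensor

variable {F G H : Type*}
  [AddCommGroup F] [Module ℝ F] [TopologicalSpace F]
  [AddCommGroup G] [Module ℝ G] [TopologicalSpace G]
  [AddCommGroup H] [Module ℝ H] [TopologicalSpace H]
  {r s : ℕ}

instance TensorSlot.instIsTopologicalAddGroup [IsTopologicalAddGroup F] :
    ∀ i, IsTopologicalAddGroup (TensorSlot F r s i)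
  | Sum.inl _ => inferInstanceAs (IsTopologicalAddGroup (F →L[ℝ] ℝ))
  | Sum.inr _ => inferInstanceAs (IsTopologicalAddGroup F)

instance TensorSlot.instT2Space [ContinuousSMul ℝ F] [T2Space F] :
    ∀ i, T2Space (TensorSlot F r s i)
  | Sum.inl _ => inferInstanceAs (T2Space (F →L[ℝ] ℝ))
  | Sum.inr _ => inferInstanceAs (T2Space F)

instance TensorSlot.instFiniteDimensional [FiniteDimensional ℝ F] :
    ∀ i, FiniteDimensional ℝ (TensorSlot F r s i)
  | Sum.inl _ => Module.Finite.of_injective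
      (ContinuousLinearMap.coeLM ℝ : (F →L[ℝ] ℝ) →ₗ[ℝ] F →ₗ[ℝ] ℝ)
      ContinuousLinearMap.coe_injective
  | Sum.inr _ => inferInstanceAs (FiniteDimensional ℝ F)

lemma slotMap_slotMap (f : F →L[ℝ] G) (g : G →L[ℝ] F) (f' : G →L[ℝ] H) (g' : H →L[ℝ] G) :
    ∀ (i : Fin r ⊕ Fin s) (x : TensorSlot F r s i),
      slotMap f' g' i (slotMap f g i x) = slotMap (f' ∘L f) (g ∘L g') i x
  | Sum.inl _, _ => rfl
  | Sum.inr _, _ => rfl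

lemma slotMap_id : ∀ (i : Fin r ⊕ Fin s) (x : TensorSlot F r s i),
    slotMap (ContinuousLinearMap.id ℝ F) (ContinuousLinearMap.id ℝ F) i x = x
  | Sum.inl _, _ => rfl
  | Sum.inr _, _ => rfl

lemma Tensor.pull_apply (f : F →L[ℝ] G) (g : G →L[ℝ] F) (T : Tensor G r s)
    (m : ∀ i, TensorSlot F r s i) : T.pull f g m = T fun i => slotMap f g i (m i) := rfl

lemma Tensor.pull_pull (f : F →L[ℝ] G) (g : G →L[ℝ] F) (f' : G →L[ℝ] H) (g' : H →L[ℝ] G)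
    (T : Tensor H r s) : (T.pull f' g').pull f g = T.pull (f' ∘L f) (g ∘L g') := by
  ext m
  simp only [Tensor.pull_apply, slotMap_slotMap]

lemma Tensor.pull_id (T : Tensor F r s) :
    T.pull (ContinuousLinearMap.id ℝ F) (ContinuousLinearMap.id ℝ F) = T := by
  ext m
  simp only [Tensor.pull_apply, slotMap_id]

lemma Tensor.pull_sub (f : F →L[ℝ] G) (g : G →L[ℝ] F) (T T' : Tensor G r s) :
    (T - T').pull f g = T.pull f g - T'.pull f g := rfl

section Derivation

variable [IsTopologicalAddGroup F] [IsTopologicalAddGroup G]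

lemma slotMap_slotDerivation {f : F →L[ℝ] G} {g : G →L[ℝ] F} {L : F →L[ℝ] F} {B : G →L[ℝ] G}
    (hf : f ∘L L = B ∘L f) (hg : L ∘L g = g ∘L B) :
    ∀ (i : Fin r ⊕ Fin s) (x : TensorSlot F r s i),
      slotMap f g i (slotDerivation L i x) = slotDerivation B i (slotMap f g i x)
  | Sum.inl _, x =>
    have h (θ : F →L[ℝ] ℝ) : (-(θ ∘L L)) ∘L g = -((θ ∘L g) ∘L B) := by
      rw [ContinuousLinearMap.neg_comp, ContinuousLinearMap.comp_assoc,
        ContinuousLinearMap.comp_assoc, hg]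
    h x
  | Sum.inr _, x => congrArg (fun K : F →L[ℝ] G => K x) hf

lemma slotDerivation_neg (L : F →L[ℝ] F) : ∀ (i : Fin r ⊕ Fin s) (x : TensorSlot F r s i),
    slotDerivation (-L) i x = -slotDerivation L i x
  | Sum.inl _, x =>
    have h (θ : F →L[ℝ] ℝ) : -(θ ∘L (-L)) = -(-(θ ∘L L)) := by
      rw [ContinuousLinearMap.comp_neg]
    h x
  | Sum.inr _, _ => rfl

lemma Tensor.derivationTerm_apply (L : F →L[ℝ] F) (T : Tensor F r s)
    (m : ∀ i, TensorSlot F r s i) :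
    T.derivationTerm L m = ∑ i, T (Function.update m i (slotDerivation L i (m i))) := by
  rw [Tensor.derivationTerm, sum_apply]
  refine Finset.sum_congr rfl fun i _ => congrArg T (funext fun j => ?_)
  rcases eq_or_ne j i with rfl | hij <;> simp [*]

lemma Tensor.derivationTerm_neg (L : F →L[ℝ] F) (T : Tensor F r s) :
    T.derivationTerm (-L) = -T.derivationTerm L := by
  ext m
  rw [neg_apply, derivationTerm_apply, derivationTerm_apply,
    ← Finset.sum_neg_distrib]
  refine Finset.sum_congr rfl fun i _ => ?_
  rw [slotDerivation_neg]
  exact MultilinearMap.map_update_neg T.toMultilinearMap _ _ _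

lemma Tensor.derivationTerm_pull {f : F →L[ℝ] G} {g : G →L[ℝ] F} {L : F →L[ℝ] F} {B : G →L[ℝ] G}
    (hf : f ∘L L = B ∘L f) (hg : L ∘L g = g ∘L B) (T : Tensor G r s) :
    (T.pull f g).derivationTerm L = (T.derivationTerm B).pull f g := by
  ext m
  rw [Tensor.pull_apply, derivationTerm_apply, derivationTerm_apply]
  refine Finset.sum_congr rfl fun i _ => congrArg T (funext fun j => ?_)
  rcases eq_or_ne j i with rfl | hij
  · simp only [Function.update_self]
    exact slotMap_slotDerivation hf hg _ _
  · simp only [Function.update_of_ne hij]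
    rfl

end Derivation

end Tensor

section PullDerivative

lemma hasDerivWithinAt_ringInverse {𝕜 R : Type*} [NontriviallyNormedField 𝕜] [NormedRing R]
    [HasSummableGeomSeries R] [NormedAlgebra 𝕜 R] {Φ : 𝕜 → R} {Φ' : R} {S : Set 𝕜} {a : 𝕜}
    {x : Rˣ} (hx : Φ a = x) (hΦ : HasDerivWithinAt Φ Φ' S a) :
    HasDerivWithinAt (fun t => Ring.inverse (Φ t)) (-(↑x⁻¹ * Φ' * ↑x⁻¹)) S a := by
  have h : HasFDerivAt Ring.inverse _ (Φ a) := hx ▸ hasFDerivAt_ringInverse (𝕜 := 𝕜) x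
  refine (h.comp_hasDerivWithinAt a hΦ).congr_deriv ?_
  rw [neg_apply, ContinuousLinearMap.mulLeftRight_apply]

variable {E : Type*} [NormedAddCommGroup E] [NormedSpace ℝ E] {r s : ℕ}
  {Φ : ℝ → E →L[ℝ] E} {B : E →L[ℝ] E} {S : Set ℝ} {a : ℝ}

lemma hasDerivWithinAt_slotMap [CompleteSpace E] (ha : Φ a = 1) (hΦ : HasDerivWithinAt Φ B S a) :
    ∀ (i : Fin r ⊕ Fin s) (x : TensorSlot E r s i),
      HasDerivWithinAt (fun t => slotMap (Φ t) (Ring.inverse (Φ t)) i x) (slotDerivation B i x) S a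
  | Sum.inl _, x =>
    have hinv : HasDerivWithinAt (fun t => Ring.inverse (Φ t)) (-B) S a :=
      (hasDerivWithinAt_ringInverse (x := 1) ha hΦ).congr_deriv (by simp)
    have h (θ : E →L[ℝ] ℝ) :
        HasDerivWithinAt (fun t => θ ∘L Ring.inverse (Φ t)) (-(θ ∘L B)) S a :=
      ((ContinuousLinearMap.compL ℝ E E ℝ θ).hasFDerivAt.comp_hasDerivWithinAt a
        hinv).congr_deriv (by simp)
    h x
  | Sum.inr _, x =>
    have h (w : E) : HasDerivWithinAt (fun t => Φ t w) (B w) S a :=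
      (hΦ.clm_apply (hasDerivWithinAt_const a S w)).congr_deriv (by simp)
    h x

lemma Tensor.hasDerivWithinAt_pull [FiniteDimensional ℝ E] {N : ℝ → Tensor E r s}
    {N' : Tensor E r s} (ha : Φ a = 1) (hΦ : HasDerivWithinAt Φ B S a)
    (hN : HasDerivWithinAt N N' S a) :
    HasDerivWithinAt (fun t => (N t).pull (Φ t) (Ring.inverse (Φ t)))
      (N' + (N a).derivationTerm B) S a := by
  have : CompleteSpace E := FiniteDimensional.complete ℝ E
  have hid (i : Fin r ⊕ Fin s) (x : TensorSlot E r s i) :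
      slotMap (Φ a) (Ring.inverse (Φ a)) i x = x := by
    rw [ha, Ring.inverse_one]
    exact slotMap_id i x
  refine hasDerivAtFilter_multilinear_iff.2 fun m => ?_
  refine (hasDerivWithinAt_multilinear_apply hN
    fun i => hasDerivWithinAt_slotMap ha hΦ i (m i)).congr_deriv ?_
  simp only [hid, add_apply, derivationTerm_apply]

end PullDerivative

/-! ### Ordinary differential equations depending on a curve of parameters -/

lemma eventually_Icc_subset_of_mem_nhdsWithin {a b : ℝ} (hab : a < b) {S : Set ℝ}
    (hS : S ∈ 𝓝[Icc a b] a) : ∀ᶠ β in 𝓝[>] a, Icc a β ⊆ S := by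
  rw [nhdsWithin_Icc_eq_nhdsGE hab] at hS
  exact (((tendsto_const_nhdsWithin self_mem_Ici).Icc
    (Filter.tendsto_id.mono_right (nhdsWithin_mono _ Ioi_subset_Ici_self))).eventually
      (Filter.eventually_smallSets_subset.2 hS))

lemma lipschitzOnWith_comp_prodMk {P Y Z : Type*} [PseudoEMetricSpace P] [PseudoEMetricSpace Y]
    [PseudoEMetricSpace Z] {F : P × Y → Z} {K : NNReal} {U : Set (P × Y)}
    (hF : LipschitzOnWith K F U) (q : P) :
    LipschitzOnWith K (fun x => F (q, x)) {x | (q, x) ∈ U} := fun x hx x' hx' => by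
  simpa [Prod.edist_eq] using hF hx hx'

section ParametrizedODE

variable {P Y : Type*} [NormedAddCommGroup Y] [NormedSpace ℝ Y] {y z : ℝ → Y}

lemma ODE_solution_unique_of_mem_uIcc {v : ℝ → Y → Y} {s : ℝ → Set Y} {K : NNReal} {t₁ t₂ : ℝ}
    (hv : ∀ t, LipschitzOnWith K (v t) (s t))
    (hy : ∀ t ∈ uIcc t₁ t₂, HasDerivWithinAt y (v t (y t)) (uIcc t₁ t₂) t)
    (hys : ∀ t ∈ uIcc t₁ t₂, y t ∈ s t)
    (hz : ∀ t ∈ uIcc t₁ t₂, HasDerivWithinAt z (v t (z t)) (uIcc t₁ t₂) t)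
    (hzs : ∀ t ∈ uIcc t₁ t₂, z t ∈ s t) (h₁ : y t₁ = z t₁) : EqOn y z (uIcc t₁ t₂) := by
  have hyc := HasDerivWithinAt.continuousOn hy
  have hzc := HasDerivWithinAt.continuousOn hz
  rcases le_total t₁ t₂ with h | h
  · rw [uIcc_of_le h] at *
    have right {x : ℝ → Y} (hx : ∀ t ∈ Icc t₁ t₂, HasDerivWithinAt x (v t (x t)) (Icc t₁ t₂) t) :
        ∀ t ∈ Ico t₁ t₂, HasDerivWithinAt x (v t (x t)) (Ici t) t := fun t ht =>
      (hx t (Ico_subset_Icc_self ht)).mono_of_mem_nhdsWithin (Icc_mem_nhdsGE_of_mem ht)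
    exact ODE_solution_unique_of_mem_Icc_right (fun t _ => hv t)
      hyc (right hy) (fun t ht => hys t (Ico_subset_Icc_self ht))
      hzc (right hz) (fun t ht => hzs t (Ico_subset_Icc_self ht)) h₁
  · rw [uIcc_of_ge h] at *
    have left {x : ℝ → Y} (hx : ∀ t ∈ Icc t₂ t₁, HasDerivWithinAt x (v t (x t)) (Icc t₂ t₁) t) :
        ∀ t ∈ Ioc t₂ t₁, HasDerivWithinAt x (v t (x t)) (Iic t) t := fun t ht =>
      (hx t (Ioc_subset_Icc_self ht)).mono_of_mem_nhdsWithin (Icc_mem_nhdsLE_of_mem ht)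
    exact ODE_solution_unique_of_mem_Icc_left (fun t _ => hv t)
      hyc (left hy) (fun t ht => hys t (Ioc_subset_Icc_self ht))
      hzc (left hz) (fun t ht => hzs t (Ioc_subset_Icc_self ht)) h₁

section Lipschitz

variable [PseudoEMetricSpace P] {F : P × Y → Y} {p : ℝ → P}

lemma ODE_param_solution_eventuallyEq {J : Set ℝ} [J.OrdConnected] {t₁ : ℝ}
    {K : NNReal} {U : Set (P × Y)} (hU : U ∈ 𝓝 (p t₁, y t₁)) (hF : LipschitzOnWith K F U)
    (hp : ContinuousWithinAt p J t₁) (ht₁ : t₁ ∈ J)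
    (hy : ∀ t ∈ J, HasDerivWithinAt y (F (p t, y t)) J t)
    (hz : ∀ t ∈ J, HasDerivWithinAt z (F (p t, z t)) J t) (h₁ : y t₁ = z t₁) :
    y =ᶠ[𝓝[J] t₁] z := by
  have hyU : ∀ᶠ t in 𝓝[J] t₁, (p t, y t) ∈ U :=
    (hp.prodMk (hy t₁ ht₁).continuousWithinAt).eventually hU
  have hzU : ∀ᶠ t in 𝓝[J] t₁, (p t, z t) ∈ U :=
    (hp.prodMk (hz t₁ ht₁).continuousWithinAt).eventually (by simpa only [h₁] using! hU)
  have huIcc : Filter.Tendsto (uIcc t₁) (𝓝[J] t₁) (𝓝[J] t₁).smallSets :=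
    (tendsto_const_nhdsWithin ht₁).uIcc Filter.tendsto_id
  filter_upwards [huIcc.eventually (hyU.and (hzU.and self_mem_nhdsWithin)).smallSets] with t ht
  have hJ : uIcc t₁ t ⊆ J := fun τ hτ => (ht τ hτ).2.2
  exact ODE_solution_unique_of_mem_uIcc (fun τ => lipschitzOnWith_comp_prodMk hF (p τ))
    (fun τ hτ => (hy τ (hJ hτ)).mono hJ) (fun τ hτ => (ht τ hτ).1)
    (fun τ hτ => (hz τ (hJ hτ)).mono hJ) (fun τ hτ => (ht τ hτ).2.1) h₁ right_mem_uIcc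

lemma exists_ODE_param_solution [CompleteSpace Y] {K : NNReal} {U : Set (P × Y)} {a b : ℝ} {y₀ : Y}
    (hab : a < b) (hU : U ∈ 𝓝 (p a, y₀)) (hF : LipschitzOnWith K F U)
    (hp : ContinuousOn p (Icc a b)) :
    ∃ β ∈ Ioc a b, ∃ y : ℝ → Y, y a = y₀ ∧
      ∀ t ∈ Icc a β, HasDerivWithinAt y (F (p t, y t)) (Icc a β) t := by
  have hbd : ∀ᶠ z in 𝓝 (p a, y₀), ‖F z‖ < ‖F (p a, y₀)‖ + 1 :=
    (hF.continuousOn.continuousAt hU).norm.eventually_lt_const (lt_add_one _)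
  obtain ⟨V, hV, B, hB, hVB⟩ := mem_nhds_prod_iff.1 (Filter.inter_mem hU hbd)
  obtain ⟨ρ, hρ, hρB⟩ := Metric.nhds_basis_closedBall.mem_iff.1 hB
  set L : ℝ := ‖F (p a, y₀)‖ + 1
  have hL₀ : 0 < L := by positivity
  have hshort : ∀ᶠ β in 𝓝[>] a, L * (β - a) ≤ ρ := by
    have : Filter.Tendsto (fun β => L * (β - a)) (𝓝 a) (𝓝 (L * (a - a))) :=
      Continuous.tendsto (by fun_prop) a
    rw [sub_self, mul_zero] at this
    exact (this.mono_left nhdsWithin_le_nhds).eventually (Iic_mem_nhds hρ)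
  obtain ⟨β, hβV, hβρ, hβ⟩ := ((eventually_Icc_subset_of_mem_nhdsWithin hab
    (hp a (left_mem_Icc.2 hab.le) hV)).and (hshort.and (Ioc_mem_nhdsGT hab))).exists
  have hmem : ∀ t ∈ Icc a β, ∀ x ∈ Metric.closedBall y₀ ρ, (p t, x) ∈ U ∧ ‖F (p t, x)‖ < L :=
    fun t ht x hx => hVB ⟨hβV ht, hρB hx⟩
  have hPL : IsPicardLindelof (fun t x => F (p t, x)) (tmin := a) (tmax := β)
      ⟨a, left_mem_Icc.2 hβ.1.le⟩ y₀ ⟨ρ, hρ.le⟩ 0 ⟨L, hL₀.le⟩ K :=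
    { lipschitzOnWith := fun t ht =>
        (lipschitzOnWith_comp_prodMk hF (p t)).mono fun x hx => (hmem t ht x hx).1
      continuousOn := fun x hx => hF.continuousOn.comp
        ((hp.mono (Icc_subset_Icc_right hβ.2)).prodMk continuousOn_const)
        fun t ht => (hmem t ht x hx).1
      norm_le := fun t ht x hx => (hmem t ht x hx).2.le
      mul_max_le := by simpa [hβ.1.le] using! hβρ }
  exact ⟨β, hβ, hPL.exists_eq_forall_mem_Icc_hasDerivWithinAt₀⟩

end Lipschitz

section Smooth

variable [NormedAddCommGroup P] [NormedSpace ℝ P] {F : P × Y → Y} {p : ℝ → P} {α β : ℝ}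

lemma ODE_param_solution_unique (hF : ∀ t ∈ Icc α β, ContDiffAt ℝ 1 F (p t, y t))
    (hp : ContinuousOn p (Icc α β))
    (hy : ∀ t ∈ Icc α β, HasDerivWithinAt y (F (p t, y t)) (Icc α β) t)
    (hz : ∀ t ∈ Icc α β, HasDerivWithinAt z (F (p t, z t)) (Icc α β) t)
    {t₀ : ℝ} (ht₀ : t₀ ∈ Icc α β) (h₀ : y t₀ = z t₀) : EqOn y z (Icc α β) := by
  have hyc := HasDerivWithinAt.continuousOn hy
  have hzc := HasDerivWithinAt.continuousOn hz
  let S : Set (Icc α β) := {t | y t = z t}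
  have hclosed : IsClosed S := isClosed_eq hyc.domRestrict hzc.domRestrict
  have hopen : IsOpen S := isOpen_iff_mem_nhds.2 fun ⟨t₁, ht₁⟩ h₁ => by
    obtain ⟨K, U, hU, hlip⟩ := (hF t₁ ht₁).exists_lipschitzOnWith
    rw [nhds_subtype_eq_comap_nhdsWithin]
    exact Filter.preimage_mem_comap
      (ODE_param_solution_eventuallyEq hU hlip (hp t₁ ht₁) ht₁ hy hz h₁)
  have := isPreconnected_iff_preconnectedSpace.1 (isPreconnected_Icc (a := α) (b := β))
  have huniv : S = univ := IsClopen.eq_univ ⟨hclosed, hopen⟩ ⟨⟨t₀, ht₀⟩, h₀⟩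
  exact fun t ht => huniv.ge (mem_univ ⟨t, ht⟩)

lemma contDiffOn_of_ODE_param {Ω : Set (P × Y)} (hF : ContDiffOn ℝ ∞ F Ω)
    (hp : ContDiffOn ℝ ∞ p (Icc α β)) (hαβ : α < β) (hΩ : ∀ t ∈ Icc α β, (p t, y t) ∈ Ω)
    (hy : ∀ t ∈ Icc α β, HasDerivWithinAt y (F (p t, y t)) (Icc α β) t) :
    ContDiffOn ℝ ∞ y (Icc α β) := by
  refine contDiffOn_infty.2 fun n => ?_
  induction n with
  | zero => exact contDiffOn_zero.2 (HasDerivWithinAt.continuousOn hy)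
  | succ n ih =>
    have hder : ContDiffOn ℝ n (fun t => F (p t, y t)) (Icc α β) :=
      (contDiffOn_infty.1 hF n).comp ((contDiffOn_infty.1 hp n).prodMk ih) hΩ
    refine (contDiffOn_succ_iff_derivWithin (uniqueDiffOn_Icc hαβ)).2
      ⟨fun t ht => (hy t ht).differentiableWithinAt, by simp, hder.congr fun t ht => ?_⟩
    exact (hy t ht).derivWithin (uniqueDiffOn_Icc hαβ t ht)

lemma exists_contDiffOn_ODE_param_solution [CompleteSpace Y] {Ω : Set (P × Y)} (hΩ : IsOpen Ω)
    (hF : ContDiffOn ℝ ∞ F Ω) {a b : ℝ} (hab : a < b) (hp : ContDiffOn ℝ ∞ p (Icc a b)) {y₀ : Y}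
    (h₀ : (p a, y₀) ∈ Ω) :
    ∃ β ∈ Ioc a b, ∃ y : ℝ → Y, y a = y₀ ∧ ContDiffOn ℝ ∞ y (Icc a β) ∧
      ∀ t ∈ Icc a β, (p t, y t) ∈ Ω ∧ HasDerivWithinAt y (F (p t, y t)) (Icc a β) t := by
  obtain ⟨K, U, hU, hlip⟩ := ((hF.contDiffAt (hΩ.mem_nhds h₀)).of_le
    (by simp)).exists_lipschitzOnWith
  obtain ⟨β₀, hβ₀, y, rfl, hy⟩ := exists_ODE_param_solution hab hU hlip hp.continuousOn
  have hβ₀b : Icc a β₀ ⊆ Icc a b := Icc_subset_Icc_right hβ₀.2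
  have haβ₀ := left_mem_Icc.2 hβ₀.1.le
  have hmem : ∀ᶠ t in 𝓝[Icc a β₀] a, (p t, y t) ∈ Ω :=
    ((hp.continuousOn.mono hβ₀b a haβ₀).prodMk (hy a haβ₀).continuousWithinAt).eventually
      (hΩ.mem_nhds h₀)
  obtain ⟨β, hβΩ, hβ⟩ := ((eventually_Icc_subset_of_mem_nhdsWithin hβ₀.1 hmem).and
    (Ioc_mem_nhdsGT hβ₀.1)).exists
  have hββ₀ : Icc a β ⊆ Icc a β₀ := Icc_subset_Icc_right hβ.2
  have hyβ : ∀ t ∈ Icc a β, HasDerivWithinAt y (F (p t, y t)) (Icc a β) t :=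
    fun t ht => (hy t (hββ₀ ht)).mono hββ₀
  exact ⟨β, ⟨hβ.1, hβ.2.trans hβ₀.2⟩, y, rfl,
    contDiffOn_of_ODE_param hF (hp.mono (hββ₀.trans hβ₀b)) hβ.1 hβΩ hyβ,
    fun t ht => ⟨hβΩ ht, hyβ t ht⟩⟩

end Smooth

end ParametrizedODE

/-! ### Locality of anisotropic connections -/

section CoordinateFields

variable {E : Type*} [NormedAddCommGroup E] [NormedSpace ℝ E]
  {M : Type*} [TopologicalSpace M] [ChartedSpace E M]

lemma hasDerivWithinAt_comp_curve (f : C^∞⟮𝓘(ℝ, E), M; ℝ⟯) {γ : ℝ → M} {a b t : ℝ}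
    (hγ : MDifferentiableWithinAt 𝓘(ℝ) 𝓘(ℝ, E) γ (Icc a b) t) :
    HasDerivWithinAt (fun τ => f (γ τ))
      (dirDeriv f (AnisotropicConnection.velocity E γ a b t)) (Icc a b) t := by
  have h : HasFDerivWithinAt (𝕜 := ℝ) (E := ℝ) (F := ℝ) (fun τ => f (γ τ)) _ (Icc a b) t :=
    ((f.contMDiff.mdifferentiable (by simp) (γ t)).hasMFDerivAt.comp_hasMFDerivWithinAt t
      hγ.hasMFDerivWithinAt).hasFDerivWithinAt
  exact h.hasDerivWithinAt

section Bump

variable [FiniteDimensional ℝ E]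

variable (E) in
/-- The bump function used in `coordExt`. -/
def coordBump (p : M) : SmoothBumpFunction 𝓘(ℝ, E) p := Classical.arbitrary _

variable (E) in
/-- A neighbourhood of `p` on which no cut-off is visible: there the fields `coordExt w` have
constant natural coordinates around `p`. -/
def coordNhd (p : M) : Set M :=
  (chartAt E p).source ∩ {q | ∀ᶠ q' in 𝓝 q, coordBump E p q' = 1}

lemma isOpen_coordNhd (p : M) : IsOpen (coordNhd E p) :=
  (chartAt E p).open_source.inter isOpen_setOfPred_eventually_nhds

lemma mem_coordNhd_self (p : M) : p ∈ coordNhd E p :=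
  ⟨mem_chart_source E p, (coordBump E p).eventuallyEq_one⟩

end Bump

variable [IsManifold 𝓘(ℝ, E) ∞ M]

variable (E) in
/-- The trivialization of `TM` given by the natural coordinates around `p`. -/
abbrev tangentTriv (p : M) : Trivialization E (π E (TangentSpace 𝓘(ℝ, E) : M → Type _)) :=
  trivializationAt E (TangentSpace 𝓘(ℝ, E)) p

lemma mem_baseSet_tangentTriv (p : M) : p ∈ (tangentTriv E p).baseSet :=
  mem_chart_source E p

lemma tangentTriv_apply_snd {p q : M} (hq : q ∈ (chartAt E p).source)
    (w : TangentSpace 𝓘(ℝ, E) q) :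
    (tangentTriv E p ⟨q, w⟩).2 = (tangentTriv E p).continuousLinearMapAt ℝ q w := by
  rw [Trivialization.continuousLinearMapAt_apply, Trivialization.coe_linearMapAt_of_mem]
  exact hq

lemma VField.mulFun_apply (f : C^∞⟮𝓘(ℝ, E), M; ℝ⟯) (X : VField E M) (q : M) :
    VField.mulFun f X q = f q • X q := rfl

lemma VField.mulFun_const_one (X : VField E M) : VField.mulFun (ContMDiffMap.const 1) X = X := by
  ext q
  exact one_smul ℝ (X q)

lemma VField.sum_apply {ι : Type*} (S : Finset ι) (X : ι → VField E M) (q : M) :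
    (∑ i ∈ S, X i) q = ∑ i ∈ S, X i q := by
  classical
  induction S using Finset.induction_on with
  | empty => rfl
  | insert i S hi ih => rw [Finset.sum_insert hi, Finset.sum_insert hi, ← ih]; rfl

variable [FiniteDimensional ℝ E]

lemma sum_repr_smul_symmL {p q : M} (hq : q ∈ (chartAt E p).source)
    (w : TangentSpace 𝓘(ℝ, E) q) :
    ∑ k, (Module.finBasis ℝ E).repr ((tangentTriv E p).continuousLinearMapAt ℝ q w) k •
      (tangentTriv E p).symmL ℝ q (Module.finBasis ℝ E k) = w := by
  simp_rw [← map_smul, ← map_sum, Module.Basis.sum_repr]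
  exact Trivialization.symmL_continuousLinearMapAt _ hq _

variable [T2Space M]

/-- The field which near `p` has the constant coordinates `w` in the natural coordinates around `p`;
this is `coordExt`, but indexed by the model space. -/
def coordFrame (p : M) (w : E) : VField E M :=
  coordExt (p := p) ((tangentTriv E p).symmL ℝ p w)

lemma coordFrame_apply (p : M) (w : E) (q : M) :
    coordFrame p w q = coordBump E p q • (tangentTriv E p).symmL ℝ q w := by
  change coordBump E p q • constField _ q = _
  rw [constField, Trivialization.continuousLinearMapAt_symmL _ (mem_baseSet_tangentTriv p)]

lemma coordFrame_of_mem {p q : M} (hq : q ∈ coordNhd E p) (w : E) :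
    coordFrame p w q = (tangentTriv E p).symmL ℝ q w := by
  rw [coordFrame_apply, hq.2.self_of_nhds, one_smul]

lemma coordExt_eq_coordFrame {p : M} (w : TangentSpace 𝓘(ℝ, E) p) :
    coordExt w = coordFrame p ((tangentTriv E p).continuousLinearMapAt ℝ p w) := by
  rw [coordFrame, Trivialization.symmL_continuousLinearMapAt _ (mem_baseSet_tangentTriv p)]

lemma coordExt_self {p : M} (w : TangentSpace 𝓘(ℝ, E) p) : coordExt w p = w := by
  rw [coordExt_eq_coordFrame, coordFrame_of_mem (mem_coordNhd_self p),
    Trivialization.symmL_continuousLinearMapAt _ (mem_baseSet_tangentTriv p)]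

lemma sum_repr_smul_coordFrame {p q : M} (hq : q ∈ coordNhd E p) (w : TangentSpace 𝓘(ℝ, E) q) :
    ∑ k, (Module.finBasis ℝ E).repr ((tangentTriv E p).continuousLinearMapAt ℝ q w) k •
      coordFrame p (Module.finBasis ℝ E k) q = w := by
  simp_rw [coordFrame_of_mem hq]
  exact sum_repr_smul_symmL hq.1 w

lemma hasDerivWithinAt_coordFrame_comp {γ : ℝ → M} {S : Set ℝ} {t : ℝ} {p : M}
    (hγ : ContinuousWithinAt γ S t) (ht : t ∈ S) (hp : γ t ∈ coordNhd E p) (w : E) :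
    HasDerivWithinAt (fun τ => (tangentTriv E p ⟨γ τ, coordFrame p w (γ τ)⟩).2) 0 S t := by
  have hconst : (fun τ => (tangentTriv E p ⟨γ τ, coordFrame p w (γ τ)⟩).2) =ᶠ[𝓝[S] t]
      fun _ => w := by
    filter_upwards [hγ.eventually ((isOpen_coordNhd p).mem_nhds hp)] with τ hτ
    rw [tangentTriv_apply_snd hτ.1, coordFrame_of_mem hτ,
      Trivialization.continuousLinearMapAt_symmL _ hτ.1]
  exact (hasDerivWithinAt_const t S w).congr_of_eventuallyEq hconst (hconst.eq_of_nhdsWithin ht)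

/-- The `k`-th component of a vector field in the natural coordinates around `p`, cut off. -/
def coordComp (p : M) (Z : VField E M) (k : Fin (Module.finrank ℝ E)) : C^∞⟮𝓘(ℝ, E), M; ℝ⟯ :=
  ⟨fun q => coordBump E p q • (Module.finBasis ℝ E).coord k (tangentTriv E p ⟨q, Z q⟩).2,
    (coordBump E p).contMDiff_smul <|
      (LinearMap.toContinuousLinearMap ((Module.finBasis ℝ E).coord k)).contMDiff.comp_contMDiffOn
        fun q hq => ((tangentTriv E p).contMDiffWithinAt_section _ hq).1
          (Z.contMDiff q).contMDiffWithinAt⟩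

lemma coordComp_apply {p q : M} (hq : q ∈ (chartAt E p).source) (Z : VField E M)
    (k : Fin (Module.finrank ℝ E)) : coordComp p Z k q = coordBump E p q *
      (Module.finBasis ℝ E).repr ((tangentTriv E p).continuousLinearMapAt ℝ q (Z q)) k := by
  rw [← tangentTriv_apply_snd hq]
  rfl

lemma coordComp_of_mem {p q : M} (hq : q ∈ coordNhd E p) (Z : VField E M)
    (k : Fin (Module.finrank ℝ E)) : coordComp p Z k q =
      (Module.finBasis ℝ E).repr ((tangentTriv E p).continuousLinearMapAt ℝ q (Z q)) k := by
  rw [coordComp_apply hq.1, hq.2.self_of_nhds, one_mul]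

/-- The square of `coordBump`: the cut-off that appears when a field is expanded with the cut-off
components `coordComp` in the cut-off frame `coordFrame`. -/
def coordCut (p : M) : C^∞⟮𝓘(ℝ, E), M; ℝ⟯ :=
  ⟨fun q => coordBump E p q • coordBump E p q,
    (coordBump E p).contMDiff.smul (coordBump E p).contMDiff⟩

lemma coordCut_apply (p q : M) : coordCut (E := E) p q = coordBump E p q * coordBump E p q := rfl

lemma coordCut_of_mem {p q : M} (hq : q ∈ coordNhd E p) : coordCut (E := E) p q = 1 := by
  rw [coordCut_apply, hq.2.self_of_nhds, one_mul]

lemma dirDeriv_coordCut (p : M) (u : TangentSpace 𝓘(ℝ, E) p) : dirDeriv (coordCut p) u = 0 := by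
  have h : (coordCut (E := E) p : M → ℝ) =ᶠ[𝓝 p] (ContMDiffMap.const 1 : C^∞⟮𝓘(ℝ, E), M; ℝ⟯) :=
    Filter.eventuallyEq_of_mem ((isOpen_coordNhd p).mem_nhds (mem_coordNhd_self p))
      fun q hq => coordCut_of_mem hq
  rw [← dirDeriv_const 1 u, dirDeriv, h.mfderiv_eq]
  rfl

lemma mulFun_coordCut (p : M) (Z : VField E M) :
    VField.mulFun (coordCut p) Z =
      ∑ k, VField.mulFun (coordComp p Z k) (coordFrame p (Module.finBasis ℝ E k)) := by
  ext q
  simp only [VField.sum_apply, VField.mulFun_apply, coordFrame_apply, coordCut_apply]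
  by_cases hq : q ∈ (chartAt E p).source
  · conv_lhs => rw [← sum_repr_smul_symmL hq (Z q)]
    simp only [coordComp_apply hq, Finset.smul_sum, smul_smul, mul_right_comm, mul_assoc]
  · have h₀ : coordBump E p q = 0 :=
      Function.notMem_support.1 fun h => hq ((coordBump E p).support_subset_source h)
    simp [h₀]

end CoordinateFields

namespace AnisotropicConnection

variable {E : Type*} [NormedAddCommGroup E] [NormedSpace ℝ E]
  {M : Type*} [TopologicalSpace M] [ChartedSpace E M] [IsManifold 𝓘(ℝ, E) ∞ M]
  {A : Set (TangentBundle 𝓘(ℝ, E) M)} (nabla : AnisotropicConnection A)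

lemma toFun_sum_right {v : TangentBundle 𝓘(ℝ, E) M} (hv : v ∈ A) {ι : Type*} (S : Finset ι)
    (X : VField E M) (f : ι → C^∞⟮𝓘(ℝ, E), M; ℝ⟯) (Y : ι → VField E M) :
    nabla.toFun X (∑ i ∈ S, VField.mulFun (f i) (Y i)) v =
      ∑ i ∈ S, (dirDeriv (f i) (X v.proj) • Y i v.proj + f i v.proj • nabla.toFun X (Y i) v) := by
  classical
  induction S using Finset.induction_on with
  | empty => simpa using nabla.add_right X 0 0 v hv
  | insert i S hi ih =>
    rw [Finset.sum_insert hi, Finset.sum_insert hi, nabla.add_right _ _ _ v hv, ih,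
      nabla.leibniz _ _ _ v hv]

lemma toFun_add_left {v : TangentBundle 𝓘(ℝ, E) M} (hv : v ∈ A) (X Y Z : VField E M) :
    nabla.toFun (X + Y) Z v = nabla.toFun X Z v + nabla.toFun Y Z v := by
  have h := nabla.linear_left (ContMDiffMap.const 1) (ContMDiffMap.const 1) X Y Z v hv
  have hc : (ContMDiffMap.const 1 : C^∞⟮𝓘(ℝ, E), M; ℝ⟯) v.proj = 1 := rfl
  rwa [VField.mulFun_const_one, VField.mulFun_const_one, hc, one_smul, one_smul] at h

lemma toFun_zero_left {v : TangentBundle 𝓘(ℝ, E) M} (hv : v ∈ A) (Z : VField E M) :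
    nabla.toFun 0 Z v = 0 := by
  simpa using nabla.toFun_add_left hv 0 0 Z

lemma toFun_mulFun_left {v : TangentBundle 𝓘(ℝ, E) M} (hv : v ∈ A)
    (f : C^∞⟮𝓘(ℝ, E), M; ℝ⟯) (X Z : VField E M) :
    nabla.toFun (VField.mulFun f X) Z v = f v.proj • nabla.toFun X Z v := by
  have h := nabla.linear_left f (ContMDiffMap.const 1) X 0 Z v hv
  rwa [VField.mulFun_const_one, add_zero, nabla.toFun_zero_left hv, smul_zero, add_zero] at h

lemma toFun_sum_left {v : TangentBundle 𝓘(ℝ, E) M} (hv : v ∈ A) {ι : Type*} (S : Finset ι)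
    (f : ι → C^∞⟮𝓘(ℝ, E), M; ℝ⟯) (X : ι → VField E M) (Z : VField E M) :
    nabla.toFun (∑ i ∈ S, VField.mulFun (f i) (X i)) Z v =
      ∑ i ∈ S, f i v.proj • nabla.toFun (X i) Z v := by
  classical
  induction S using Finset.induction_on with
  | empty => exact nabla.toFun_zero_left hv Z
  | insert i S hi ih =>
    rw [Finset.sum_insert hi, Finset.sum_insert hi, nabla.toFun_add_left hv,
      nabla.toFun_mulFun_left hv, ih]

variable [FiniteDimensional ℝ E] [T2Space M]

lemma toFun_congr_left {v : TangentBundle 𝓘(ℝ, E) M} (hv : v ∈ A) {X X' : VField E M}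
    (Z : VField E M) (h : X v.proj = X' v.proj) : nabla.toFun X Z v = nabla.toFun X' Z v := by
  have hp := mem_coordNhd_self (E := E) v.proj
  have key (X : VField E M) : nabla.toFun X Z v =
      ∑ k, coordComp v.proj X k v.proj •
        nabla.toFun (coordFrame v.proj (Module.finBasis ℝ E k)) Z v := by
    rw [← nabla.toFun_sum_left hv, ← mulFun_coordCut, nabla.toFun_mulFun_left hv,
      coordCut_of_mem hp, one_smul]
  rw [key X, key X']
  simp only [coordComp_of_mem hp, h]

section Curve

variable {γ : ℝ → M} {a b t : ℝ} {v : TangentSpace 𝓘(ℝ, E) (γ t)}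

lemma covDerivAlong_eq_sum (hab : a < b) (ht : t ∈ Icc a b)
    (hγ : ContinuousWithinAt γ (Icc a b) t)
    (hv : (⟨γ t, v⟩ : TangentBundle 𝓘(ℝ, E) M) ∈ A) {ι : Type*} [Fintype ι]
    {X : ∀ τ, TangentSpace 𝓘(ℝ, E) (γ τ)} {Z : ι → ∀ τ, TangentSpace 𝓘(ℝ, E) (γ τ)}
    {f : ι → ℝ → ℝ} {f' : ι → ℝ}
    (hX : ∀ᶠ τ in 𝓝[Icc a b] t, X τ = ∑ k, f k τ • Z k τ)
    (hf : ∀ k, HasDerivWithinAt (f k) (f' k) (Icc a b) t)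
    (hZ : ∀ k, DifferentiableWithinAt ℝ
      (fun τ => (tangentTriv E (γ t) ⟨γ τ, Z k τ⟩).2) (Icc a b) t) :
    nabla.covDerivAlong γ a b X t v =
      ∑ k, (f' k • Z k t + f k t • nabla.covDerivAlong γ a b (Z k) t v) := by
  have hsrc : ∀ᶠ τ in 𝓝[Icc a b] t, γ τ ∈ (chartAt E (γ t)).source :=
    hγ.eventually ((chartAt E (γ t)).open_source.mem_nhds (mem_chart_source E (γ t)))
  have hev : (fun τ => (tangentTriv E (γ t) ⟨γ τ, X τ⟩).2) =ᶠ[𝓝[Icc a b] t]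
      fun τ => ∑ k, f k τ • (tangentTriv E (γ t) ⟨γ τ, Z k τ⟩).2 := by
    filter_upwards [hX, hsrc] with τ h1 h2
    simp_rw [tangentTriv_apply_snd h2, h1, map_sum, map_smul]
  have hd := ((HasDerivWithinAt.fun_sum (u := Finset.univ)
    fun k _ => (hf k).fun_smul (hZ k).hasDerivWithinAt).congr_of_eventuallyEq hev
    (hev.eq_of_nhdsWithin ht)).derivWithin (uniqueDiffOn_Icc hab t ht)
  have hlin (w) : nabla.christoffel v (velocity E γ a b t) w =
      nabla.christoffelMap v hv (velocity E γ a b t) w := rfl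
  simp only [covDerivAlong, hlin]
  rw [hd, hX.self_of_nhdsWithin ht, map_sum, map_sum, ← Finset.sum_add_distrib]
  refine Finset.sum_congr rfl fun k _ => ?_
  rw [map_add, map_smul, map_smul, map_smul, tangentTriv_apply_snd (mem_chart_source E (γ t)),
    Trivialization.symmL_continuousLinearMapAt _ (mem_baseSet_tangentTriv _), smul_add]
  abel

lemma covDerivAlong_coordFrame (hab : a < b) (ht : t ∈ Icc a b)
    (hγ : ContinuousWithinAt γ (Icc a b) t)
    (hv : (⟨γ t, v⟩ : TangentBundle 𝓘(ℝ, E) M) ∈ A) {X : VField E M}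
    (hX : X (γ t) = velocity E γ a b t) (w : E) :
    nabla.covDerivAlong γ a b (fun τ => coordFrame (γ t) w (γ τ)) t v =
      nabla.toFun X (coordFrame (γ t) w) ⟨γ t, v⟩ := by
  have hd : derivWithin (fun τ => (tangentTriv E (γ t) ⟨γ τ, coordFrame (γ t) w (γ τ)⟩).2)
      (Icc a b) t = 0 :=
    (hasDerivWithinAt_coordFrame_comp hγ ht (mem_coordNhd_self _) w).derivWithin
      (uniqueDiffOn_Icc hab t ht)
  rw [covDerivAlong, hd, map_zero, zero_add, coordFrame_of_mem (mem_coordNhd_self _)]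
  exact nabla.toFun_congr_left hv _ ((coordExt_self _).trans hX.symm)

lemma toFun_eq_covDerivAlong (hab : a < b) (ht : t ∈ Icc a b)
    (hγ : MDifferentiableWithinAt 𝓘(ℝ) 𝓘(ℝ, E) γ (Icc a b) t)
    (hv : (⟨γ t, v⟩ : TangentBundle 𝓘(ℝ, E) M) ∈ A) {X : VField E M}
    (hX : X (γ t) = velocity E γ a b t) (Z : VField E M) :
    nabla.toFun X Z ⟨γ t, v⟩ = nabla.covDerivAlong γ a b (fun τ => Z (γ τ)) t v := by
  have hp := mem_coordNhd_self (E := E) (γ t)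
  have hcut : nabla.toFun X Z ⟨γ t, v⟩ =
      nabla.toFun X (VField.mulFun (coordCut (γ t)) Z) ⟨γ t, v⟩ := by
    rw [nabla.leibniz _ _ _ _ hv, dirDeriv_coordCut, coordCut_of_mem hp, zero_smul, zero_add,
      one_smul]
  have hZ : ∀ᶠ τ in 𝓝[Icc a b] t, Z (γ τ) =
      ∑ k, coordComp (γ t) Z k (γ τ) • coordFrame (γ t) (Module.finBasis ℝ E k) (γ τ) := by
    filter_upwards [hγ.continuousWithinAt.eventually ((isOpen_coordNhd _).mem_nhds hp)] with τ hτ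
    simp only [coordComp_of_mem hτ, sum_repr_smul_coordFrame hτ]
  rw [hcut, mulFun_coordCut, nabla.toFun_sum_right hv,
    nabla.covDerivAlong_eq_sum hab ht hγ.continuousWithinAt hv hZ
      (fun k => hasDerivWithinAt_comp_curve _ hγ) fun k => (hasDerivWithinAt_coordFrame_comp
        hγ.continuousWithinAt ht hp (Module.finBasis ℝ E k)).differentiableWithinAt]
  simp only [nabla.covDerivAlong_coordFrame hab ht hγ.continuousWithinAt hv hX, hX]

end Curve

end AnisotropicConnection

/-! ### Natural coordinates on the tangent bundle -/

section Coordinates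

variable {E : Type*} [NormedAddCommGroup E] [NormedSpace ℝ E]
  {M : Type*} [TopologicalSpace M] [ChartedSpace E M]

variable [IsManifold 𝓘(ℝ, E) ∞ M]

/-- The tangent vector with natural coordinates `z = (x, y)` around `p`. -/
def coordPt (p : M) (z : E × E) : TangentBundle 𝓘(ℝ, E) M :=
  ⟨(extChartAt 𝓘(ℝ, E) p).symm z.1,
    (tangentTriv E p).symmL ℝ ((extChartAt 𝓘(ℝ, E) p).symm z.1) z.2⟩

/-- The natural coordinates around `p` of a tangent vector. -/
def coordOf (p : M) (v : TangentBundle 𝓘(ℝ, E) M) : E × E :=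
  (extChartAt 𝓘(ℝ, E) p v.proj, (tangentTriv E p).continuousLinearMapAt ℝ v.proj v.2)

lemma coordPt_proj_mem {p : M} {z : E × E} (hz : z.1 ∈ (extChartAt 𝓘(ℝ, E) p).target) :
    (coordPt p z).proj ∈ (chartAt E p).source := by
  rw [← extChartAt_source 𝓘(ℝ, E)]
  exact (extChartAt 𝓘(ℝ, E) p).map_target hz

lemma coordPt_coordOf {p : M} {v : TangentBundle 𝓘(ℝ, E) M}
    (hv : v.proj ∈ (chartAt E p).source) : coordPt p (coordOf p v) = v := by
  obtain ⟨q, v⟩ := v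
  have h1 : (extChartAt 𝓘(ℝ, E) p).symm (extChartAt 𝓘(ℝ, E) p q) = q :=
    (extChartAt 𝓘(ℝ, E) p).left_inv (by rwa [extChartAt_source])
  have h2 : ∀ q', q' = q → (⟨q', (tangentTriv E p).symmL ℝ q'
      ((tangentTriv E p).continuousLinearMapAt ℝ q v)⟩ : TangentBundle 𝓘(ℝ, E) M) = ⟨q, v⟩ := by
    rintro _ rfl
    rw [Trivialization.symmL_continuousLinearMapAt _ hv]
  exact h2 _ h1

lemma contMDiffOn_coordPt (p : M) : ContMDiffOn 𝓘(ℝ, E × E) 𝓘(ℝ, E).tangent ∞ (coordPt p)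
    ((extChartAt 𝓘(ℝ, E) p).target ×ˢ univ) := by
  refine ((tangentTriv E p).contMDiffOn_iff
    (fun z hz => (Trivialization.mem_source _).2 (coordPt_proj_mem hz.1))).2 ⟨?_, ?_⟩
  · exact (contMDiffOn_extChartAt_symm p).comp contDiff_fst.contMDiff.contMDiffOn fun z hz => hz.1
  · refine (contDiff_snd.contMDiff.contMDiffOn (f := (Prod.snd : E × E → E))).congr ?_
    rintro z hz
    have hz' : (coordPt p z).proj ∈ (chartAt E p).source := coordPt_proj_mem hz.1
    exact (tangentTriv_apply_snd hz' _).trans (Trivialization.continuousLinearMapAt_symmL _ hz' _)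

/-- The coordinates of the elements of `A` over the chart around `p`. -/
def coordDom (A : Set (TangentBundle 𝓘(ℝ, E) M)) (p : M) : Set (E × E) :=
  ((extChartAt 𝓘(ℝ, E) p).target ×ˢ univ) ∩ coordPt p ⁻¹' A

lemma isOpen_coordDom {A : Set (TangentBundle 𝓘(ℝ, E) M)} (hA : IsOpen A) (p : M) :
    IsOpen (coordDom A p) :=
  (contMDiffOn_coordPt p).continuousOn.isOpen_inter_preimage
    ((isOpen_extChartAt_target p).prod isOpen_univ) hA

lemma coordOf_mem_coordDom {A : Set (TangentBundle 𝓘(ℝ, E) M)} {p : M}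
    {v : TangentBundle 𝓘(ℝ, E) M} (hv : v ∈ A) (hp : v.proj ∈ (chartAt E p).source) :
    coordOf p v ∈ coordDom A p := by
  refine ⟨⟨?_, mem_univ _⟩, ?_⟩
  · exact (extChartAt 𝓘(ℝ, E) p).map_source (by rwa [extChartAt_source])
  · rwa [mem_preimage, coordPt_coordOf hp]

lemma contMDiffWithinAt_curve_iff {γ : ℝ → M} {X : ∀ t, TangentSpace 𝓘(ℝ, E) (γ t)}
    {S : Set ℝ} {t : ℝ} {p : M} (hγ : ContMDiffWithinAt 𝓘(ℝ) 𝓘(ℝ, E) ∞ γ S t)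
    (hp : γ t ∈ (chartAt E p).source) :
    ContMDiffWithinAt 𝓘(ℝ) 𝓘(ℝ, E).tangent ∞
      (fun τ => (⟨γ τ, X τ⟩ : TangentBundle 𝓘(ℝ, E) M)) S t ↔
    ContDiffWithinAt ℝ ∞ (fun τ => (tangentTriv E p ⟨γ τ, X τ⟩).2) S t := by
  have h := (tangentTriv E p).contMDiffWithinAt_iff (IB := 𝓘(ℝ, E)) (IM := 𝓘(ℝ)) (n := ∞)
    (f := fun τ => (⟨γ τ, X τ⟩ : TangentBundle 𝓘(ℝ, E) M)) (s := S) (x₀ := t)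
    ((Trivialization.mem_source _).2 hp)
  rw [← contMDiffWithinAt_iff_contDiffWithinAt]
  exact h.trans (and_iff_right hγ)

lemma hasDerivWithinAt_chart_curve {γ : ℝ → M} {a b t : ℝ} {p : M}
    (hγ : MDifferentiableWithinAt 𝓘(ℝ) 𝓘(ℝ, E) γ (Icc a b) t)
    (hp : γ t ∈ (chartAt E p).source) :
    HasDerivWithinAt (fun τ => extChartAt 𝓘(ℝ, E) p (γ τ))
      ((tangentTriv E p).continuousLinearMapAt ℝ (γ t)
        (AnisotropicConnection.velocity E γ a b t)) (Icc a b) t := by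
  have h : HasFDerivWithinAt (𝕜 := ℝ) (E := ℝ) (F := E)
      (fun τ => extChartAt 𝓘(ℝ, E) p (γ τ)) _ (Icc a b) t :=
    ((mdifferentiableAt_extChartAt hp).hasMFDerivAt.comp_hasMFDerivWithinAt t
      hγ.hasMFDerivWithinAt).hasFDerivWithinAt
  rw [TangentBundle.continuousLinearMapAt_trivializationAt hp]
  exact h.hasDerivWithinAt

variable [FiniteDimensional ℝ E] [T2Space M]

lemma coordFrame_eq_sum (p : M) (w : E) : coordFrame p w =
    ∑ k, VField.mulFun (ContMDiffMap.const ((Module.finBasis ℝ E).repr w k))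
      (coordFrame p (Module.finBasis ℝ E k)) := by
  have hmul (c : ℝ) (X : VField E M) (q : M) :
      VField.mulFun (ContMDiffMap.const c) X q = c • X q := rfl
  ext q
  simp only [VField.sum_apply, hmul, coordFrame_apply, smul_comm _ (coordBump E p q)]
  rw [← Finset.smul_sum]
  congr 1
  simp_rw [← map_smul, ← map_sum, Module.Basis.sum_repr]

end Coordinates

/-! ### Christoffel symbols -/

namespace AnisotropicConnection

variable {E : Type*} [NormedAddCommGroup E] [NormedSpace ℝ E]
  {M : Type*} [TopologicalSpace M] [ChartedSpace E M] [IsManifold 𝓘(ℝ, E) ∞ M]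
  [FiniteDimensional ℝ E] [T2Space M]
  {A : Set (TangentBundle 𝓘(ℝ, E) M)} (nabla : AnisotropicConnection A)

/-- The components of `∇_{∂ᵢ} ∂ⱼ` in the natural coordinates around `p`, at the tangent vector with
coordinates `z`. -/
def christoffelComp (p : M) (i j : Fin (Module.finrank ℝ E)) (z : E × E) : E :=
  (tangentTriv E p ⟨(coordPt p z).proj, nabla.toFun (coordFrame p (Module.finBasis ℝ E i))
    (coordFrame p (Module.finBasis ℝ E j)) (coordPt p z)⟩).2

/-- The Christoffel symbols in the natural coordinates around `p`, as a bilinear map. Unlike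
`christoffel`, which uses at each `v ∈ TM` the chart around the base point of `v`, they all refer to
one chart. -/
def christoffelCoord (p : M) (z : E × E) : E →L[ℝ] E →L[ℝ] E :=
  (Module.finBasis ℝ E).constrL fun i =>
    (Module.finBasis ℝ E).constrL fun j => nabla.christoffelComp p i j z

lemma christoffelCoord_eq_sum (p : M) (z : E × E) (u w : E) :
    nabla.christoffelCoord p z u w = ∑ i, ∑ j, (Module.finBasis ℝ E).repr u i •
      (Module.finBasis ℝ E).repr w j • nabla.christoffelComp p i j z := by
  simp only [christoffelCoord, Module.Basis.constrL_apply, sum_apply, smul_apply,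
    Finset.smul_sum, Module.Basis.equivFun_apply]

lemma contDiffOn_christoffelComp (p : M) (i j : Fin (Module.finrank ℝ E)) :
    ContDiffOn ℝ ∞ (nabla.christoffelComp p i j) (coordDom A p) := by
  have h := (nabla.smooth (coordFrame p (Module.finBasis ℝ E i))
    (coordFrame p (Module.finBasis ℝ E j))).comp ((contMDiffOn_coordPt p).mono inter_subset_left)
    (inter_subset_right : coordDom A p ⊆ _)
  refine contMDiffOn_iff_contDiffOn.1 (((tangentTriv E p).contMDiffOn_iff ?_).1 h).2
  exact fun z hz => (Trivialization.mem_source _).2 (coordPt_proj_mem hz.1.1)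

lemma contDiffOn_christoffelCoord (p : M) :
    ContDiffOn ℝ ∞ (nabla.christoffelCoord p) (coordDom A p) := by
  refine contDiffOn_clm_apply.2 fun u => contDiffOn_clm_apply.2 fun w => ?_
  simp only [christoffelCoord_eq_sum]
  exact ContDiffOn.sum fun i _ => ContDiffOn.sum fun j _ =>
    ((nabla.contDiffOn_christoffelComp p i j).const_smul _).const_smul _

lemma toFun_coordFrame_eq_sum {v : TangentBundle 𝓘(ℝ, E) M} (hv : v ∈ A) (p : M) (u w : E) :
    nabla.toFun (coordFrame p u) (coordFrame p w) v = ∑ i, ∑ j, (Module.finBasis ℝ E).repr u i •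
      (Module.finBasis ℝ E).repr w j • nabla.toFun (coordFrame p (Module.finBasis ℝ E i))
        (coordFrame p (Module.finBasis ℝ E j)) v := by
  rw [coordFrame_eq_sum p u, nabla.toFun_sum_left hv]
  refine Finset.sum_congr rfl fun i _ => ?_
  rw [coordFrame_eq_sum p w, nabla.toFun_sum_right hv, Finset.smul_sum]
  refine Finset.sum_congr rfl fun j _ => ?_
  rw [dirDeriv_const, zero_smul, zero_add]
  rfl

lemma christoffelCoord_apply {p : M} {v : TangentBundle 𝓘(ℝ, E) M} (hv : v ∈ A)
    (hp : v.proj ∈ (chartAt E p).source) (u w : E) :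
    nabla.christoffelCoord p (coordOf p v) u w = (tangentTriv E p).continuousLinearMapAt ℝ v.proj
      (nabla.toFun (coordFrame p u) (coordFrame p w) v) := by
  have hcomp (i j) : nabla.christoffelComp p i j (coordOf p v) =
      (tangentTriv E p).continuousLinearMapAt ℝ v.proj (nabla.toFun
        (coordFrame p (Module.finBasis ℝ E i)) (coordFrame p (Module.finBasis ℝ E j)) v) := by
    rw [christoffelComp, coordPt_coordOf hp, tangentTriv_apply_snd hp]
  simp only [christoffelCoord_eq_sum, hcomp, nabla.toFun_coordFrame_eq_sum hv p u w, map_sum,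
    map_smul]

lemma christoffelCoord_self {p : M} {v : TangentSpace 𝓘(ℝ, E) p}
    (hv : (⟨p, v⟩ : TangentBundle 𝓘(ℝ, E) M) ∈ A) (u w : TangentSpace 𝓘(ℝ, E) p) :
    nabla.christoffelCoord p (coordOf p ⟨p, v⟩)
        ((tangentTriv E p).continuousLinearMapAt ℝ p u)
        ((tangentTriv E p).continuousLinearMapAt ℝ p w) =
      (tangentTriv E p).continuousLinearMapAt ℝ p (nabla.christoffel v u w) := by
  rw [nabla.christoffelCoord_apply hv (mem_chart_source E p), christoffel,
    coordExt_eq_coordFrame u, coordExt_eq_coordFrame w]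

section Curve

variable {γ : ℝ → M} {a b t : ℝ} {v : TangentSpace 𝓘(ℝ, E) (γ t)} {p : M}

lemma covDerivAlong_coordFrame_of_mem_coordNhd (hab : a < b) (ht : t ∈ Icc a b)
    (hγ : MDifferentiableWithinAt 𝓘(ℝ) 𝓘(ℝ, E) γ (Icc a b) t)
    (hv : (⟨γ t, v⟩ : TangentBundle 𝓘(ℝ, E) M) ∈ A) (hp : γ t ∈ coordNhd E p) (w : E) :
    nabla.covDerivAlong γ a b (fun τ => coordFrame p w (γ τ)) t v =
      (tangentTriv E p).symmL ℝ (γ t) (nabla.christoffelCoord p (coordOf p ⟨γ t, v⟩)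
        ((tangentTriv E p).continuousLinearMapAt ℝ (γ t) (velocity E γ a b t)) w) := by
  have hu : coordFrame p ((tangentTriv E p).continuousLinearMapAt ℝ (γ t)
      (velocity E γ a b t)) (γ t) = velocity E γ a b t := by
    rw [coordFrame_of_mem hp, Trivialization.symmL_continuousLinearMapAt _ hp.1]
  rw [nabla.christoffelCoord_apply hv hp.1, Trivialization.symmL_continuousLinearMapAt _ hp.1,
    nabla.toFun_eq_covDerivAlong hab ht hγ hv hu]

lemma covDerivAlong_eq_coord (hab : a < b) (ht : t ∈ Icc a b)
    (hγ : ContMDiffWithinAt 𝓘(ℝ) 𝓘(ℝ, E) ∞ γ (Icc a b) t)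
    (hv : (⟨γ t, v⟩ : TangentBundle 𝓘(ℝ, E) M) ∈ A) (hp : γ t ∈ coordNhd E p)
    {X : ∀ τ, TangentSpace 𝓘(ℝ, E) (γ τ)} {X' : E}
    (hX : HasDerivWithinAt (fun τ => (tangentTriv E p ⟨γ τ, X τ⟩).2) X' (Icc a b) t) :
    nabla.covDerivAlong γ a b X t v = (tangentTriv E p).symmL ℝ (γ t)
      (X' + nabla.christoffelCoord p (coordOf p ⟨γ t, v⟩)
        ((tangentTriv E p).continuousLinearMapAt ℝ (γ t) (velocity E γ a b t))
        ((tangentTriv E p).continuousLinearMapAt ℝ (γ t) (X t))) := by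
  let B := Module.finBasis ℝ E
  have hsum : ∀ᶠ τ in 𝓝[Icc a b] t, X τ =
      ∑ k, B.repr (tangentTriv E p ⟨γ τ, X τ⟩).2 k • coordFrame p (B k) (γ τ) := by
    filter_upwards [hγ.continuousWithinAt.eventually ((isOpen_coordNhd p).mem_nhds hp)] with τ hτ
    rw [tangentTriv_apply_snd hτ.1, sum_repr_smul_coordFrame hτ]
  have hcomp (k) : HasDerivWithinAt (fun τ => B.repr (tangentTriv E p ⟨γ τ, X τ⟩).2 k)
      (B.repr X' k) (Icc a b) t :=
    (LinearMap.toContinuousLinearMap (B.coord k)).hasFDerivAt.comp_hasDerivWithinAt t hX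
  have hframe (k) : DifferentiableWithinAt ℝ
      (fun τ => (tangentTriv E (γ t) ⟨γ τ, coordFrame p (B k) (γ τ)⟩).2) (Icc a b) t :=
    ((contMDiffWithinAt_curve_iff hγ (mem_chart_source E (γ t))).1
      (((coordFrame p (B k)).contMDiff (γ t)).comp_contMDiffWithinAt t hγ)).differentiableWithinAt
      (by simp)
  rw [nabla.covDerivAlong_eq_sum hab ht hγ.continuousWithinAt hv hsum hcomp hframe]
  simp_rw [nabla.covDerivAlong_coordFrame_of_mem_coordNhd hab ht
    (hγ.mdifferentiableWithinAt (by simp)) hv hp, coordFrame_of_mem hp, ← map_smul,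
    Finset.sum_add_distrib, ← map_sum, B.sum_repr, tangentTriv_apply_snd hp.1, map_add]

end Curve

end AnisotropicConnection

/-! ### Parallel transport for short times -/

namespace AnisotropicConnection

variable {E : Type*} [NormedAddCommGroup E] [NormedSpace ℝ E]
  {M : Type*} [TopologicalSpace M] [ChartedSpace E M] [IsManifold 𝓘(ℝ, E) ∞ M]

/-- The position and velocity of the curve `γ : [a, b] → M` in the natural coordinates
around `p`. -/
def coordCurve (p : M) (γ : ℝ → M) (a b t : ℝ) : E × E :=
  (extChartAt 𝓘(ℝ, E) p (γ t),
    (tangentTriv E p).continuousLinearMapAt ℝ (γ t) (velocity E γ a b t))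

lemma contDiffOn_coordCurve {p : M} {γ : ℝ → M} {a b β : ℝ} (hβ : β ∈ Ioc a b)
    (hγ : ContMDiffOn 𝓘(ℝ) 𝓘(ℝ, E) ∞ γ (Icc a b))
    (hp : ∀ t ∈ Icc a β, γ t ∈ (chartAt E p).source) :
    ContDiffOn ℝ ∞ (coordCurve (E := E) p γ a b) (Icc a β) := by
  have hsub : Icc a β ⊆ Icc a b := Icc_subset_Icc_right hβ.2
  have hpos : ContDiffOn ℝ ∞ (fun t => extChartAt 𝓘(ℝ, E) p (γ t)) (Icc a β) :=
    contMDiffOn_iff_contDiffOn.1 (contMDiffOn_extChartAt.comp (hγ.mono hsub) hp)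
  have huniq : UniqueDiffOn ℝ (Icc a β) := uniqueDiffOn_Icc hβ.1
  refine hpos.prodMk ((hpos.derivWithin huniq (m := ∞) (by simp)).congr fun t ht => ?_)
  have hderiv := hasDerivWithinAt_chart_curve
    ((hγ t (hsub ht)).mdifferentiableWithinAt (by simp)) (hp t ht)
  exact ((hderiv.mono hsub).derivWithin (huniq t ht)).symm

/-- The field along `γ` with natural coordinates `Y` around `γ a`. -/
def coordField (γ : ℝ → M) (a : ℝ) (Y : ℝ → E) (t : ℝ) : TangentSpace 𝓘(ℝ, E) (γ t) :=
  (tangentTriv E (γ a)).symmL ℝ (γ t) (Y t)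

/-- The map `T_{γ(t₁)}M → T_{γ(t₂)}M` which is `Φ(t₂) ∘ Φ(t₁)⁻¹` in the natural coordinates around
`γ a`: the parallel transport if the columns of `Φ` are parallel. -/
def frameTransport (γ : ℝ → M) (a : ℝ) (Φ : ℝ → E →L[ℝ] E) (t₁ t₂ : ℝ) :
    TangentSpace 𝓘(ℝ, E) (γ t₁) →L[ℝ] TangentSpace 𝓘(ℝ, E) (γ t₂) :=
  (tangentTriv E (γ a)).symmL ℝ (γ t₂) ∘L (Φ t₂ ∘L Ring.inverse (Φ t₁)) ∘L
    (tangentTriv E (γ a)).continuousLinearMapAt ℝ (γ t₁)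

variable [FiniteDimensional ℝ E] [T2Space M]
  {A : Set (TangentBundle 𝓘(ℝ, E) M)} (nabla : AnisotropicConnection A)

/-- The coefficient of the equation of parallel transport in the natural coordinates around `p`: a
field with coordinates `w` is parallel with respect to the observer with coordinates `y` along a
curve with position and velocity `c` if `ẇ = parallelCoeff p (c, y) w`. -/
def parallelCoeff (p : M) (z : (E × E) × E) : E →L[ℝ] E :=
  -nabla.christoffelCoord p (z.1.1, z.2) z.1.2

lemma contDiffOn_parallelCoeff (p : M) :
    ContDiffOn ℝ ∞ (nabla.parallelCoeff p) {z | (z.1.1, z.2) ∈ coordDom A p} :=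
  (((nabla.contDiffOn_christoffelCoord p).comp (f := fun z : (E × E) × E => (z.1.1, z.2))
    (by fun_prop) fun _ hz => hz).clm_apply (by fun_prop)).neg

lemma IsParallelOn.hasDerivWithinAt {γ : ℝ → M} {a b t : ℝ} {J : Set ℝ}
    {W X : ∀ t, TangentSpace 𝓘(ℝ, E) (γ t)} {nabla : AnisotropicConnection A}
    (h : nabla.IsParallelOn γ a b J W X) (hab : a < b) (htI : t ∈ Icc a b)
    (hγ : ContMDiffWithinAt 𝓘(ℝ) 𝓘(ℝ, E) ∞ γ (Icc a b) t) (ht : t ∈ J)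
    (hJ : J ∈ 𝓝[Icc a b] t) {p : M} (hp : γ t ∈ coordNhd E p)
    (hW : (⟨γ t, W t⟩ : TangentBundle 𝓘(ℝ, E) M) ∈ A) :
    HasDerivWithinAt (fun τ => (tangentTriv E p ⟨γ τ, X τ⟩).2)
      (nabla.parallelCoeff p (coordCurve p γ a b t, (tangentTriv E p ⟨γ t, W t⟩).2)
        (tangentTriv E p ⟨γ t, X t⟩).2) (Icc a b) t := by
  have hX := (((contMDiffWithinAt_curve_iff hγ hp.1).1
    ((h.smooth t ht).mono_of_mem_nhdsWithin hJ)).differentiableWithinAt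
      (by simp)).hasDerivWithinAt
  have hpar := congrArg ((tangentTriv E p).continuousLinearMapAt ℝ (γ t)) (h.parallel t ht)
  rw [nabla.covDerivAlong_eq_coord hab htI hγ hW hp hX,
    Trivialization.continuousLinearMapAt_symmL _ hp.1, map_zero] at hpar
  refine hX.congr_deriv ((eq_neg_of_add_eq_zero_left hpar).trans ?_)
  rw [tangentTriv_apply_snd hp.1, tangentTriv_apply_snd hp.1]
  rfl

/-- On `[a, β]`, the endomorphisms `Φ t` are, in the natural coordinates around `γ a`, the parallel
transport from `γ a` to `γ t` with respect to the observer with coordinates `y` at `γ a`. -/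
structure IsParallelFrame (γ : ℝ → M) (a b β : ℝ) (y : E) (Φ : ℝ → E →L[ℝ] E) : Prop where
  mem_Ioc : β ∈ Ioc a b
  initial : Φ a = 1
  smooth : ContDiffOn ℝ ∞ Φ (Icc a β)
  mem_nhd : ∀ t ∈ Icc a β, γ t ∈ coordNhd E (γ a)
  mem_dom : ∀ t ∈ Icc a β, (extChartAt 𝓘(ℝ, E) (γ a) (γ t), Φ t y) ∈ coordDom A (γ a)
  isUnit : ∀ t ∈ Icc a β, IsUnit (Φ t)
  deriv : ∀ t ∈ Icc a β, HasDerivWithinAt Φ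
    (nabla.parallelCoeff (γ a) (coordCurve (γ a) γ a b t, Φ t y) ∘L Φ t) (Icc a β) t

lemma exists_isParallelFrame (hA : IsOpen A) {γ : ℝ → M} {a b : ℝ} (hab : a < b)
    (hγ : ContMDiffOn 𝓘(ℝ) 𝓘(ℝ, E) ∞ γ (Icc a b)) {y : E}
    (hy : (extChartAt 𝓘(ℝ, E) (γ a) (γ a), y) ∈ coordDom A (γ a)) :
    ∃ β Φ, nabla.IsParallelFrame γ a b β y Φ := by
  have : CompleteSpace E := FiniteDimensional.complete ℝ E
  obtain ⟨b', hnhd, hb'⟩ := ((eventually_Icc_subset_of_mem_nhdsWithin hab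
    ((hγ.continuousOn a (left_mem_Icc.2 hab.le)).preimage_mem_nhdsWithin
      ((isOpen_coordNhd (γ a)).mem_nhds (mem_coordNhd_self (E := E) (γ a))))).and
    (Ioc_mem_nhdsGT hab)).exists
  let Ω : Set ((E × E) × (E →L[ℝ] E)) := {z | (z.1.1, z.2 y) ∈ coordDom A (γ a)}
  have hΩ : IsOpen Ω := (isOpen_coordDom hA (γ a)).preimage (by fun_prop)
  have hF : ContDiffOn ℝ ∞ (fun z : (E × E) × (E →L[ℝ] E) =>
      nabla.parallelCoeff (γ a) (z.1, z.2 y) ∘L z.2) Ω :=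
    ((nabla.contDiffOn_parallelCoeff (γ a)).comp
      (f := fun z : (E × E) × (E →L[ℝ] E) => (z.1, z.2 y)) (by fun_prop)
      fun _ hz => hz).clm_comp contDiff_snd.contDiffOn
  obtain ⟨β₀, hβ₀, Φ, hΦa, hsmooth, hΦ⟩ := exists_contDiffOn_ODE_param_solution hΩ hF hb'.1
    (contDiffOn_coordCurve hb' hγ fun t ht => (hnhd ht).1) (y₀ := (1 : E →L[ℝ] E)) hy
  obtain ⟨β, hunit, hβ⟩ := ((eventually_Icc_subset_of_mem_nhdsWithin hβ₀.1
    ((hsmooth.continuousOn a (left_mem_Icc.2 hβ₀.1.le)).preimage_mem_nhdsWithin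
      (Units.isOpen.mem_nhds (hΦa ▸ isUnit_one)))).and (Ioc_mem_nhdsGT hβ₀.1)).exists
  have hsub : Icc a β ⊆ Icc a β₀ := Icc_subset_Icc_right hβ.2
  exact ⟨β, Φ,
    { mem_Ioc := ⟨hβ.1, hβ.2.trans (hβ₀.2.trans hb'.2)⟩
      initial := hΦa
      smooth := hsmooth.mono hsub
      mem_nhd := fun t ht => hnhd (Icc_subset_Icc_right hβ₀.2 (hsub ht))
      mem_dom := fun t ht => (hΦ t (hsub ht)).1
      isUnit := fun t ht => hunit ht
      deriv := fun t ht => (hΦ t (hsub ht)).2.mono hsub }⟩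

namespace IsParallelFrame

variable {nabla} {γ : ℝ → M} {a b β t t₁ t₂ : ℝ} {y : E} {Φ : ℝ → E →L[ℝ] E}

lemma lt (h : nabla.IsParallelFrame γ a b β y Φ) : a < b :=
  h.mem_Ioc.1.trans_le h.mem_Ioc.2

lemma Icc_subset (h : nabla.IsParallelFrame γ a b β y Φ) : Icc a β ⊆ Icc a b :=
  Icc_subset_Icc_right h.mem_Ioc.2

lemma snd_coordField (h : nabla.IsParallelFrame γ a b β y Φ) (Y : ℝ → E) (ht : t ∈ Icc a β) :
    (tangentTriv E (γ a) ⟨γ t, coordField γ a Y t⟩).2 = Y t := by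
  rw [tangentTriv_apply_snd (h.mem_nhd t ht).1, coordField,
    Trivialization.continuousLinearMapAt_symmL _ (h.mem_nhd t ht).1]

lemma eq_coordField (h : nabla.IsParallelFrame γ a b β y Φ) {Y : ℝ → E} (ht : t ∈ Icc a β)
    {X : TangentSpace 𝓘(ℝ, E) (γ t)} (hX : Y t = (tangentTriv E (γ a) ⟨γ t, X⟩).2) :
    X = coordField γ a Y t := by
  rw [coordField, hX, tangentTriv_apply_snd (h.mem_nhd t ht).1,
    Trivialization.symmL_continuousLinearMapAt _ (h.mem_nhd t ht).1]

lemma coordOf_coordField (h : nabla.IsParallelFrame γ a b β y Φ) (Y : ℝ → E)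
    (ht : t ∈ Icc a β) :
    coordOf (γ a) ⟨γ t, coordField γ a Y t⟩ = (extChartAt 𝓘(ℝ, E) (γ a) (γ t), Y t) := by
  rw [← h.snd_coordField Y ht, tangentTriv_apply_snd (h.mem_nhd t ht).1]
  rfl

lemma coordField_inverse (h : nabla.IsParallelFrame γ a b β y Φ) (ht : t ∈ Icc a β)
    (x : TangentSpace 𝓘(ℝ, E) (γ t)) :
    coordField γ a (Φ · (Ring.inverse (Φ t)
      ((tangentTriv E (γ a)).continuousLinearMapAt ℝ (γ t) x))) t = x := by
  have hinv := Ring.mul_inverse_cancel _ (h.isUnit t ht)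
  refine (h.eq_coordField ht ?_).symm
  rw [tangentTriv_apply_snd (h.mem_nhd t ht).1]
  exact DFunLike.congr_fun hinv _

lemma admissible (h : nabla.IsParallelFrame γ a b β y Φ) (ht : t ∈ Icc a β) :
    (⟨γ t, coordField γ a (Φ · y) t⟩ : TangentBundle 𝓘(ℝ, E) M) ∈ A := by
  have hmem := (h.mem_dom t ht).2
  rwa [← h.coordOf_coordField (Φ · y) ht, mem_preimage,
    coordPt_coordOf (h.mem_nhd t ht).1] at hmem

lemma hasDerivWithinAt_apply (h : nabla.IsParallelFrame γ a b β y Φ) (ht : t ∈ Icc a β) (w : E) :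
    HasDerivWithinAt (fun τ => Φ τ w)
      (nabla.parallelCoeff (γ a) (coordCurve (γ a) γ a b t, Φ t y) (Φ t w)) (Icc a β) t := by
  simpa using (h.deriv t ht).clm_apply (hasDerivWithinAt_const t _ w)

lemma Ico_mem_nhdsWithin (ht : t ∈ Ico a β) : Ico a β ∈ 𝓝[Icc a b] t := by
  filter_upwards [self_mem_nhdsWithin, mem_nhdsWithin_of_mem_nhds (Iio_mem_nhds ht.2)]
    with τ hτ hτβ using ⟨hτ.1, hτβ⟩

lemma isTransportInterval (h : nabla.IsParallelFrame γ a b β y Φ)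
    (ht₁ : t₁ ∈ Ico a β) (ht₂ : t₂ ∈ Ico a β) : IsTransportInterval a b (Ico a β) t₁ t₂ where
  subset := Ico_subset_Icc_self.trans h.Icc_subset
  ordConnected := ordConnected_Ico
  mem_nhdsWithin _ ht := Ico_mem_nhdsWithin ht
  left_mem := ht₁
  right_mem := ht₂

lemma contMDiffOn_coordField (h : nabla.IsParallelFrame γ a b β y Φ)
    (hγ : ContMDiffOn 𝓘(ℝ) 𝓘(ℝ, E) ∞ γ (Icc a b)) (w : E) :
    ContMDiffOn 𝓘(ℝ) 𝓘(ℝ, E).tangent ∞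
      (fun t => (⟨γ t, coordField γ a (Φ · w) t⟩ : TangentBundle 𝓘(ℝ, E) M)) (Icc a β) := by
  intro t ht
  refine (contMDiffWithinAt_curve_iff ((hγ t (h.Icc_subset ht)).mono h.Icc_subset)
    (h.mem_nhd t ht).1).2 ?_
  exact (h.smooth.clm_apply contDiffOn_const t ht).congr (fun τ hτ => h.snd_coordField _ hτ)
    (h.snd_coordField _ ht)

lemma isParallelOn (h : nabla.IsParallelFrame γ a b β y Φ)
    (hγ : ContMDiffOn 𝓘(ℝ) 𝓘(ℝ, E) ∞ γ (Icc a b)) (w : E) :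
    nabla.IsParallelOn γ a b (Ico a β) (coordField γ a (Φ · y)) (coordField γ a (Φ · w)) := by
  refine ⟨(h.contMDiffOn_coordField hγ w).mono Ico_subset_Icc_self, fun t ht => ?_⟩
  have htβ := Ico_subset_Icc_self ht
  have hw : HasDerivWithinAt
      (fun τ => (tangentTriv E (γ a) ⟨γ τ, coordField γ a (Φ · w) τ⟩).2)
      (nabla.parallelCoeff (γ a) (coordCurve (γ a) γ a b t, Φ t y) (Φ t w)) (Icc a b) t :=
    ((h.hasDerivWithinAt_apply htβ w).congr (fun τ hτ => h.snd_coordField (Φ · w) hτ)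
      (h.snd_coordField (Φ · w) htβ)).mono_of_mem_nhdsWithin
        (Filter.mem_of_superset (Ico_mem_nhdsWithin ht) Ico_subset_Icc_self)
  rw [nabla.covDerivAlong_eq_coord h.lt (h.Icc_subset htβ) (hγ t (h.Icc_subset htβ))
    (h.admissible htβ) (h.mem_nhd t htβ) hw, h.coordOf_coordField _ htβ,
    ← tangentTriv_apply_snd (h.mem_nhd t htβ).1 (coordField γ a (Φ · w) t),
    h.snd_coordField _ htβ, parallelCoeff, neg_apply, coordCurve, neg_add_cancel, map_zero]

lemma isParallelObserverOn (h : nabla.IsParallelFrame γ a b β y Φ)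
    (hγ : ContMDiffOn 𝓘(ℝ) 𝓘(ℝ, E) ∞ γ (Icc a b)) :
    nabla.IsParallelObserverOn γ a b (Ico a β) (coordField γ a (Φ · y)) :=
  ⟨fun _ ht => h.admissible (Ico_subset_Icc_self ht), h.isParallelOn hγ y⟩

lemma continuousOn_coordCurve (h : nabla.IsParallelFrame γ a b β y Φ)
    (hγ : ContMDiffOn 𝓘(ℝ) 𝓘(ℝ, E) ∞ γ (Icc a b)) :
    ContinuousOn (coordCurve (E := E) (γ a) γ a b) (Icc a β) :=
  (contDiffOn_coordCurve h.mem_Ioc hγ fun t ht => (h.mem_nhd t ht).1).continuousOn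

lemma continuousOn_parallelCoeff (h : nabla.IsParallelFrame γ a b β y Φ)
    (hγ : ContMDiffOn 𝓘(ℝ) 𝓘(ℝ, E) ∞ γ (Icc a b)) :
    ContinuousOn (fun t => nabla.parallelCoeff (γ a) (coordCurve (γ a) γ a b t, Φ t y))
      (Icc a β) :=
  (nabla.contDiffOn_parallelCoeff (γ a)).continuousOn.comp
    ((h.continuousOn_coordCurve hγ).prodMk (h.smooth.continuousOn.clm_apply continuousOn_const))
    h.mem_dom

section Uniqueness

variable {J : Set ℝ} {V W : ∀ t, TangentSpace 𝓘(ℝ, E) (γ t)}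

lemma uIcc_subset (ht₁ : t₁ ∈ Ico a β) (ht₂ : t₂ ∈ Ico a β) : uIcc t₁ t₂ ⊆ Icc a β :=
  uIcc_subset_Icc (Ico_subset_Icc_self ht₁) (Ico_subset_Icc_self ht₂)

lemma hasDerivWithinAt_of_isParallelOn (h : nabla.IsParallelFrame γ a b β y Φ)
    (hγ : ContMDiffOn 𝓘(ℝ) 𝓘(ℝ, E) ∞ γ (Icc a b))
    (ht₁ : t₁ ∈ Ico a β) (ht₂ : t₂ ∈ Ico a β) (hJ : IsTransportInterval a b J t₁ t₂)
    (hV : nabla.IsParallelObserverOn γ a b J V) (hW : nabla.IsParallelOn γ a b J V W)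
    (ht : t ∈ uIcc t₁ t₂) :
    HasDerivWithinAt (fun τ => (tangentTriv E (γ a) ⟨γ τ, W τ⟩).2)
      (nabla.parallelCoeff (γ a)
        (coordCurve (γ a) γ a b t, (tangentTriv E (γ a) ⟨γ t, V t⟩).2)
        (tangentTriv E (γ a) ⟨γ t, W t⟩).2) (uIcc t₁ t₂) t := by
  have hsub := uIcc_subset ht₁ ht₂
  have htJ : t ∈ J := hJ.ordConnected.uIcc_subset hJ.left_mem hJ.right_mem ht
  have htI := h.Icc_subset (hsub ht)
  exact (hW.hasDerivWithinAt h.lt htI (hγ t htI) htJ (hJ.mem_nhdsWithin t htJ)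
    (h.mem_nhd t (hsub ht)) (hV.admissible t htJ)).mono (hsub.trans h.Icc_subset)

lemma observer_unique (h : nabla.IsParallelFrame γ a b β y Φ) (hA : IsOpen A)
    (hγ : ContMDiffOn 𝓘(ℝ) 𝓘(ℝ, E) ∞ γ (Icc a b))
    (ht₁ : t₁ ∈ Ico a β) (ht₂ : t₂ ∈ Ico a β) (hJ : IsTransportInterval a b J t₁ t₂)
    (hV : nabla.IsParallelObserverOn γ a b J V) (h₁ : V t₁ = coordField γ a (Φ · y) t₁)
    (ht : t ∈ uIcc t₁ t₂) : V t = coordField γ a (Φ · y) t := by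
  have hsub := uIcc_subset ht₁ ht₂
  have hcoeff : ∀ t ∈ uIcc t₁ t₂, ContDiffAt ℝ 1
      (fun z : (E × E) × E => nabla.parallelCoeff (γ a) z z.2)
      (coordCurve (γ a) γ a b t, Φ t y) := fun t ht => by
    have hdom : {z : (E × E) × E | (z.1.1, z.2) ∈ coordDom A (γ a)} ∈
        𝓝 (coordCurve (γ a) γ a b t, Φ t y) :=
      ((isOpen_coordDom hA (γ a)).preimage (by fun_prop)).mem_nhds (h.mem_dom t (hsub ht))
    exact (((nabla.contDiffOn_parallelCoeff (γ a)).contDiffAt hdom).of_le (by simp)).clm_apply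
      contDiff_snd.contDiffAt
  have hsnd : EqOn (Φ · y) (fun t => (tangentTriv E (γ a) ⟨γ t, V t⟩).2) (uIcc t₁ t₂) :=
    ODE_param_solution_unique hcoeff ((h.continuousOn_coordCurve hγ).mono hsub)
      (fun t ht => (h.hasDerivWithinAt_apply (hsub ht) y).mono hsub)
      (fun t ht => h.hasDerivWithinAt_of_isParallelOn hγ ht₁ ht₂ hJ hV hV.parallel ht)
      left_mem_uIcc (by rw [h₁, h.snd_coordField _ (Ico_subset_Icc_self ht₁)])
  exact h.eq_coordField (hsub ht) (hsnd ht)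

lemma parallel_unique (h : nabla.IsParallelFrame γ a b β y Φ) (hA : IsOpen A)
    (hγ : ContMDiffOn 𝓘(ℝ) 𝓘(ℝ, E) ∞ γ (Icc a b)) (ht₁ : t₁ ∈ Ico a β) (ht₂ : t₂ ∈ Ico a β)
    (hW : nabla.IsParallelWrtObserver γ a b t₁ t₂ (coordField γ a (Φ · y) t₁) W) {w : E}
    (h₁ : W t₁ = coordField γ a (Φ · w) t₁) : W t₂ = coordField γ a (Φ · w) t₂ := by
  obtain ⟨J, V, hJ, hV₁, hV, hW⟩ := hW
  have hsub := uIcc_subset ht₁ ht₂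
  have hVΦ (t) (ht : t ∈ uIcc t₁ t₂) : (tangentTriv E (γ a) ⟨γ t, V t⟩).2 = Φ t y := by
    rw [h.observer_unique hA hγ ht₁ ht₂ hJ hV hV₁ ht, h.snd_coordField _ (hsub ht)]
  have hsnd : EqOn (Φ · w) (fun t => (tangentTriv E (γ a) ⟨γ t, W t⟩).2) (uIcc t₁ t₂) :=
    ODE_param_solution_unique (F := fun z : (E →L[ℝ] E) × E => z.1 z.2) (fun _ _ => by fun_prop)
      ((h.continuousOn_parallelCoeff hγ).mono hsub)
      (fun t ht => (h.hasDerivWithinAt_apply (hsub ht) w).mono hsub)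
      (fun t ht => (h.hasDerivWithinAt_of_isParallelOn hγ ht₁ ht₂ hJ hV hW ht).congr_deriv
        (by rw [hVΦ t ht]))
      left_mem_uIcc (by rw [h₁, h.snd_coordField _ (Ico_subset_Icc_self ht₁)])
  exact h.eq_coordField (hsub right_mem_uIcc) (hsnd right_mem_uIcc)

end Uniqueness

lemma observerTransport_eq (h : nabla.IsParallelFrame γ a b β y Φ) (hA : IsOpen A)
    (hγ : ContMDiffOn 𝓘(ℝ) 𝓘(ℝ, E) ∞ γ (Icc a b)) (ht₁ : t₁ ∈ Ico a β) (ht₂ : t₂ ∈ Ico a β) :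
    nabla.observerTransport γ a b t₁ t₂ (coordField γ a (Φ · y) t₁) =
      coordField γ a (Φ · y) t₂ := by
  have hex : ∃ V : ∀ t, TangentSpace 𝓘(ℝ, E) (γ t), V t₁ = coordField γ a (Φ · y) t₁ ∧
      ∃ J, IsTransportInterval a b J t₁ t₂ ∧ nabla.IsParallelObserverOn γ a b J V :=
    ⟨_, rfl, _, h.isTransportInterval ht₁ ht₂, h.isParallelObserverOn hγ⟩
  rw [observerTransport, dif_pos hex]
  obtain ⟨h₁, J, hJ, hV⟩ := hex.choose_spec
  exact h.observer_unique hA hγ ht₁ ht₂ hJ hV h₁ right_mem_uIcc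

lemma transport_eq (h : nabla.IsParallelFrame γ a b β y Φ) (hA : IsOpen A)
    (hγ : ContMDiffOn 𝓘(ℝ) 𝓘(ℝ, E) ∞ γ (Icc a b)) (ht₁ : t₁ ∈ Ico a β) (ht₂ : t₂ ∈ Ico a β) :
    nabla.transport γ a b t₁ t₂ (coordField γ a (Φ · y) t₁) = frameTransport γ a Φ t₁ t₂ := by
  have hex : ∃ L : TangentSpace 𝓘(ℝ, E) (γ t₁) →L[ℝ] TangentSpace 𝓘(ℝ, E) (γ t₂),
      ∀ w, ∃ W : ∀ t, TangentSpace 𝓘(ℝ, E) (γ t),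
        nabla.IsParallelWrtObserver γ a b t₁ t₂ (coordField γ a (Φ · y) t₁) W ∧
          W t₁ = w ∧ W t₂ = L w :=
    ⟨frameTransport γ a Φ t₁ t₂, fun w => ⟨_, ⟨_, _, h.isTransportInterval ht₁ ht₂, rfl,
      h.isParallelObserverOn hγ, h.isParallelOn hγ _⟩,
      h.coordField_inverse (Ico_subset_Icc_self ht₁) w, rfl⟩⟩
  rw [transport, dif_pos hex]
  ext w
  obtain ⟨W, hW, hW₁, hW₂⟩ := hex.choose_spec w
  rw [← hW₂, h.parallel_unique hA hγ ht₁ ht₂ hW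
    (hW₁.trans (h.coordField_inverse (Ico_subset_Icc_self ht₁) w).symm)]
  rfl

end IsParallelFrame

end AnisotropicConnection

/-! ### Anisotropic tensors in natural coordinates -/

lemma Tensor.hasDerivAtFilter_pull_const {F G : Type*}
    [AddCommGroup F] [Module ℝ F] [TopologicalSpace F] [ContinuousSMul ℝ F] [FiniteDimensional ℝ F]
    [AddCommGroup G] [Module ℝ G] [TopologicalSpace G] [ContinuousSMul ℝ G] [FiniteDimensional ℝ G]
    {r s : ℕ} (f : F →L[ℝ] G) (g : G →L[ℝ] F) {N : ℝ → Tensor G r s} {N' : Tensor G r s}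
    {l : Filter (ℝ × ℝ)} (hN : HasDerivAtFilter N N' l) :
    HasDerivAtFilter (fun t => (N t).pull f g) (N'.pull f g) l :=
  hasDerivAtFilter_multilinear_iff.2 fun _ => hasDerivAtFilter_multilinear_iff.1 hN _

section TensorCoord

variable {E : Type*} [NormedAddCommGroup E] [NormedSpace ℝ E]
  {M : Type*} [TopologicalSpace M] [ChartedSpace E M] [IsManifold 𝓘(ℝ, E) ∞ M] {r s : ℕ}

/-- The tensor at `q` with coordinate representation `N` in the natural coordinates around `x`,
inverse to `Tensor.inChart`. -/
def Tensor.ofChart (x q : M) (N : Tensor E r s) : Tensor (TangentSpace 𝓘(ℝ, E) q) r s :=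
  N.pull ((tangentTriv E x).continuousLinearMapAt ℝ q) ((tangentTriv E x).symmL ℝ q)

lemma Tensor.ofChart_inChart {x q : M} (hq : q ∈ (chartAt E x).source)
    (T : Tensor (TangentSpace 𝓘(ℝ, E) q) r s) : Tensor.ofChart x q (T.inChart x) = T := by
  have hid : (tangentTriv E x).symmL ℝ q ∘L (tangentTriv E x).continuousLinearMapAt ℝ q =
      ContinuousLinearMap.id ℝ _ :=
    ContinuousLinearMap.ext fun w => Trivialization.symmL_continuousLinearMapAt _ hq w
  rw [ofChart, inChart, pull_pull, hid, pull_id]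

namespace AnisotropicTensor

variable {A : Set (TangentBundle 𝓘(ℝ, E) M)} (T : AnisotropicTensor A r s)

/-- The components of an anisotropic tensor field in the natural coordinates around `p`. -/
def coord (p : M) (z : E × E) : Tensor E r s :=
  (T.toFun (coordPt p z)).inChart p

lemma coord_coordOf {p : M} {v : TangentBundle 𝓘(ℝ, E) M}
    (hv : v.proj ∈ (chartAt E p).source) : T.coord p (coordOf p v) = (T.toFun v).inChart p := by
  rw [coord, coordPt_coordOf hv]

lemma contDiffOn_coord (p : M) (m : ∀ i, TensorSlot E r s i) :
    ContDiffOn ℝ ∞ (fun z => T.coord p z m) (coordDom A p) :=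
  contMDiffOn_iff_contDiffOn.1 <| (T.smooth p m).comp
    ((contMDiffOn_coordPt p).mono inter_subset_left)
    fun _ hz => ⟨hz.2, coordPt_proj_mem hz.1.1⟩

lemma hasFDerivAt_coord (hA : IsOpen A) {p : M} {z : E × E} (hz : z ∈ coordDom A p)
    (m : ∀ i, TensorSlot E r s i) :
    HasFDerivAt (fun z => T.coord p z m) (fderiv ℝ (fun z => T.coord p z m) z) z :=
  (((T.contDiffOn_coord p m).contDiffAt
    ((isOpen_coordDom hA p).mem_nhds hz)).differentiableAt (by simp)).hasFDerivAt

lemma hasDerivAt_coord_line_apply (hA : IsOpen A) {p : M} {z : E × E} (hz : z ∈ coordDom A p)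
    (d : E × E) (m : ∀ i, TensorSlot E r s i) :
    HasDerivAt (fun τ : ℝ => T.coord p (z + τ • d) m)
      (fderiv ℝ (fun z => T.coord p z m) z d) 0 := by
  have hline : HasDerivAt (fun τ : ℝ => z + τ • d) d 0 := by
    simpa using ((hasDerivAt_id (0 : ℝ)).smul_const d).const_add z
  exact (T.hasFDerivAt_coord hA hz m).comp_hasDerivAt_of_eq (0 : ℝ) hline (by simp)

/-- The derivative at `z` of the components of `T` in the direction `d`, in the natural coordinates
around `p`. -/
def coordDeriv (p : M) (z d : E × E) : Tensor E r s :=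
  deriv (fun τ : ℝ => T.coord p (z + τ • d)) 0

variable [FiniteDimensional ℝ E]

lemma coordDeriv_apply (hA : IsOpen A) {p : M} {z : E × E} (hz : z ∈ coordDom A p) (d : E × E)
    (m : ∀ i, TensorSlot E r s i) :
    T.coordDeriv p z d m = fderiv ℝ (fun z => T.coord p z m) z d :=
  deriv_multilinear_apply (fun m => T.hasDerivAt_coord_line_apply hA hz d m) m

lemma hasDerivAt_coord_line (hA : IsOpen A) {p : M} {z : E × E} (hz : z ∈ coordDom A p)
    (d : E × E) : HasDerivAt (fun τ : ℝ => T.coord p (z + τ • d)) (T.coordDeriv p z d) 0 := by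
  refine hasDerivAtFilter_multilinear_iff.2 fun m => ?_
  rw [T.coordDeriv_apply hA hz]
  exact T.hasDerivAt_coord_line_apply hA hz d m

lemma coordDeriv_sub (hA : IsOpen A) {p : M} {z : E × E} (hz : z ∈ coordDom A p) (d d' : E × E) :
    T.coordDeriv p z (d - d') = T.coordDeriv p z d - T.coordDeriv p z d' := by
  ext m
  simp only [sub_apply, T.coordDeriv_apply hA hz, map_sub]

lemma hasDerivWithinAt_coord (hA : IsOpen A) {p : M} {c : ℝ → E × E} {c' : E × E} {S : Set ℝ}
    {a : ℝ} (hmem : c a ∈ coordDom A p) (hc : HasDerivWithinAt c c' S a) :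
    HasDerivWithinAt (fun t => T.coord p (c t)) (T.coordDeriv p (c a) c') S a := by
  refine hasDerivAtFilter_multilinear_iff.2 fun m => ?_
  rw [T.coordDeriv_apply hA hmem]
  exact (T.hasFDerivAt_coord hA hmem m).comp_hasDerivWithinAt a hc

end AnisotropicTensor

end TensorCoord

namespace AnisotropicConnection

variable {E : Type*} [NormedAddCommGroup E] [NormedSpace ℝ E] [FiniteDimensional ℝ E]
  {M : Type*} [TopologicalSpace M] [ChartedSpace E M] [IsManifold 𝓘(ℝ, E) ∞ M] [T2Space M]
  {r s : ℕ} {A : Set (TangentBundle 𝓘(ℝ, E) M)}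

/-- The components of `(∇_u T)_v` in the natural coordinates around `p`, where `z = ((x, u), y)`
consists of the coordinates `(x, y)` of `v` and the components of `u`. -/
def covDerivCoord (nabla : AnisotropicConnection A) (T : AnisotropicTensor A r s) (p : M)
    (z : (E × E) × E) : Tensor E r s :=
  T.coordDeriv p (z.1.1, z.2) (z.1.2, nabla.parallelCoeff p z z.2) +
    (T.coord p (z.1.1, z.2)).derivationTerm (nabla.parallelCoeff p z)

namespace IsParallelFrame

variable {nabla : AnisotropicConnection A} {γ : ℝ → M} {a b β t : ℝ} {y : E} {Φ : ℝ → E →L[ℝ] E}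

lemma tensorTransport_eq (h : nabla.IsParallelFrame γ a b β y Φ) (hA : IsOpen A)
    (hγ : ContMDiffOn 𝓘(ℝ) 𝓘(ℝ, E) ∞ γ (Icc a b)) (T : AnisotropicTensor A r s)
    (ht : t ∈ Ico a β) :
    nabla.tensorTransport T γ a b t a (coordField γ a (Φ · y) a) = Tensor.ofChart (γ a) (γ a)
      ((T.coord (γ a) (extChartAt 𝓘(ℝ, E) (γ a) (γ t), Φ t y)).pull (Φ t)
        (Ring.inverse (Φ t))) := by
  have ha : a ∈ Ico a β := left_mem_Ico.2 h.mem_Ioc.1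
  have htβ := Ico_subset_Icc_self ht
  rw [tensorTransport, h.observerTransport_eq hA hγ ha ht, h.transport_eq hA hγ ha ht,
    h.transport_eq hA hγ ht ha, ← h.coordOf_coordField (Φ · y) htβ,
    T.coord_coordOf (h.mem_nhd t htβ).1, Tensor.inChart, Tensor.ofChart, Tensor.pull_pull,
    Tensor.pull_pull, frameTransport, frameTransport, h.initial, Ring.inverse_one]
  rfl

lemma hasDerivWithinAt_coord_pull (h : nabla.IsParallelFrame γ a b β y Φ) (hA : IsOpen A)
    (hγ : ContMDiffOn 𝓘(ℝ) 𝓘(ℝ, E) ∞ γ (Icc a b)) (T : AnisotropicTensor A r s) :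
    HasDerivWithinAt
      (fun t => (T.coord (γ a) (extChartAt 𝓘(ℝ, E) (γ a) (γ t), Φ t y)).pull (Φ t)
        (Ring.inverse (Φ t)))
      (nabla.covDerivCoord T (γ a) (coordCurve (γ a) γ a b a, y)) (Icc a b) a := by
  have ha : a ∈ Icc a β := left_mem_Icc.2 h.mem_Ioc.1.le
  have hβ : Icc a β ∈ 𝓝[Icc a b] a := Filter.mem_of_superset
    (Ico_mem_nhdsWithin (left_mem_Ico.2 h.mem_Ioc.1)) Ico_subset_Icc_self
  have hy : Φ a y = y := by rw [h.initial, one_apply_eq_self]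
  have hΦ : HasDerivWithinAt Φ (nabla.parallelCoeff (γ a) (coordCurve (γ a) γ a b a, y))
      (Icc a b) a := by
    refine ((h.deriv a ha).mono_of_mem_nhdsWithin hβ).congr_deriv ?_
    rw [hy, h.initial]
    rfl
  have hpos := hasDerivWithinAt_chart_curve
    ((hγ a (h.Icc_subset ha)).mdifferentiableWithinAt (by simp)) (mem_chart_source E (γ a))
  have hobs := (h.hasDerivWithinAt_apply ha y).mono_of_mem_nhdsWithin hβ
  have hcoord := T.hasDerivWithinAt_coord hA (h.mem_dom a ha) (hpos.prodMk hobs)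
  have hpull := Tensor.hasDerivWithinAt_pull h.initial hΦ hcoord
  simp only [hy] at hpull
  exact hpull

end IsParallelFrame

end AnisotropicConnection

/-! ### The covariant derivative in natural coordinates -/

section CovDeriv

variable {E : Type*} [NormedAddCommGroup E] [NormedSpace ℝ E]
  {M : Type*} [TopologicalSpace M] [ChartedSpace E M] [IsManifold 𝓘(ℝ, E) ∞ M]
  {r s : ℕ} {A : Set (TangentBundle 𝓘(ℝ, E) M)} {p : M}

open AnisotropicConnection (chartLine) in
lemma AnisotropicTensor.deriv_horizontal_line (T : AnisotropicTensor A r s)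
    (v u : TangentSpace 𝓘(ℝ, E) p) :
    deriv (fun τ : ℝ => (T.toFun ⟨chartLine u τ, constField v (chartLine u τ)⟩).inChart p) 0 =
      T.coordDeriv p (coordOf p ⟨p, v⟩)
        ((tangentTriv E p).continuousLinearMapAt ℝ p u, 0) := by
  have hline (τ : ℝ) :
      coordPt p (coordOf p ⟨p, v⟩ + τ • ((tangentTriv E p).continuousLinearMapAt ℝ p u, 0)) =
        ⟨chartLine u τ, constField v (chartLine u τ)⟩ := by
    simp only [coordOf, Prod.smul_mk, smul_zero, Prod.mk_add_mk, add_zero]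
    rfl
  have hcoord (τ : ℝ) := congrArg (fun w => (T.toFun w).inChart p) (hline τ)
  exact congrArg (deriv · 0) (funext hcoord).symm

variable [FiniteDimensional ℝ E]

lemma Tensor.hasDerivAtFilter_ofChart (x q : M) {N : ℝ → Tensor E r s} {N' : Tensor E r s}
    {l : Filter (ℝ × ℝ)} (hN : HasDerivAtFilter N N' l) :
    HasDerivAtFilter (fun t => Tensor.ofChart x q (N t)) (Tensor.ofChart x q N') l :=
  have : FiniteDimensional ℝ (TangentSpace 𝓘(ℝ, E) q) := inferInstanceAs (FiniteDimensional ℝ E)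
  Tensor.hasDerivAtFilter_pull_const _ _ hN

lemma AnisotropicTensor.deriv_vertical_line (T : AnisotropicTensor A r s) (hA : IsOpen A)
    {v : TangentSpace 𝓘(ℝ, E) p} (hv : (⟨p, v⟩ : TangentBundle 𝓘(ℝ, E) M) ∈ A)
    (w : TangentSpace 𝓘(ℝ, E) p) :
    deriv (F := Tensor (TangentSpace 𝓘(ℝ, E) p) r s) (fun τ : ℝ => T.toFun ⟨p, v + τ • w⟩) 0 =
      Tensor.ofChart p p (T.coordDeriv p (coordOf p ⟨p, v⟩)
        (0, (tangentTriv E p).continuousLinearMapAt ℝ p w)) := by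
  have hp := mem_chart_source E p
  have hline (τ : ℝ) : T.toFun ⟨p, v + τ • w⟩ = Tensor.ofChart p p (T.coord p
      (coordOf p ⟨p, v⟩ + τ • (0, (tangentTriv E p).continuousLinearMapAt ℝ p w))) := by
    have hz : coordOf p ⟨p, v⟩ + τ • (0, (tangentTriv E p).continuousLinearMapAt ℝ p w) =
        coordOf p ⟨p, v + τ • w⟩ := by
      simp [coordOf]
    rw [hz, T.coord_coordOf hp, Tensor.ofChart_inChart hp]
  simp_rw [hline]
  exact deriv_eq_of_hasDerivAt (Tensor.hasDerivAtFilter_ofChart p p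
    (T.hasDerivAt_coord_line hA (coordOf_mem_coordDom hv hp) _))

namespace AnisotropicConnection

variable [T2Space M] (nabla : AnisotropicConnection A)

lemma derivationTerm_christoffelMap (T : AnisotropicTensor A r s) {v : TangentSpace 𝓘(ℝ, E) p}
    (hv : (⟨p, v⟩ : TangentBundle 𝓘(ℝ, E) M) ∈ A) (u : TangentSpace 𝓘(ℝ, E) p) :
    (T.toFun ⟨p, v⟩).derivationTerm (nabla.christoffelMap v hv u) =
      Tensor.ofChart p p ((T.coord p (coordOf p ⟨p, v⟩)).derivationTerm
        (nabla.christoffelCoord p (coordOf p ⟨p, v⟩)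
          ((tangentTriv E p).continuousLinearMapAt ℝ p u))) := by
  have hp := mem_baseSet_tangentTriv (E := E) p
  rw [T.coord_coordOf hp, Tensor.ofChart, ← Tensor.derivationTerm_pull, ← Tensor.ofChart,
    Tensor.ofChart_inChart hp]
  · ext w
    exact (nabla.christoffelCoord_self hv u w).symm
  · ext y
    have h := nabla.christoffelCoord_self hv u ((tangentTriv E p).symmL ℝ p y)
    rw [Trivialization.continuousLinearMapAt_symmL _ hp] at h
    rw [ContinuousLinearMap.comp_apply, ContinuousLinearMap.comp_apply, h,
      Trivialization.symmL_continuousLinearMapAt _ hp]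
    rfl

lemma covDeriv_eq_ofChart (hA : IsOpen A) (T : AnisotropicTensor A r s)
    {v : TangentSpace 𝓘(ℝ, E) p} (hv : (⟨p, v⟩ : TangentBundle 𝓘(ℝ, E) M) ∈ A)
    (u : TangentSpace 𝓘(ℝ, E) p) :
    nabla.covDeriv T v hv u = Tensor.ofChart p p (nabla.covDerivCoord T p
      ((extChartAt 𝓘(ℝ, E) p p, (tangentTriv E p).continuousLinearMapAt ℝ p u),
        (tangentTriv E p).continuousLinearMapAt ℝ p v)) := by
  let e := (tangentTriv E p).continuousLinearMapAt ℝ p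
  let z := coordOf p ⟨p, v⟩
  let Γ := nabla.christoffelCoord p z (e u)
  have hz : z ∈ coordDom A p := coordOf_mem_coordDom hv (mem_chart_source E p)
  have hsplit : T.coordDeriv p z (e u, -Γ (e v)) =
      T.coordDeriv p z (e u, 0) - T.coordDeriv p z (0, Γ (e v)) := by
    rw [← T.coordDeriv_sub hA hz]
    simp
  calc nabla.covDeriv T v hv u
      = Tensor.ofChart p p (T.coordDeriv p z (e u, 0)) -
          Tensor.ofChart p p (T.coordDeriv p z (0, e (nabla.christoffel v u v))) -
          Tensor.ofChart p p ((T.coord p z).derivationTerm Γ) := by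
        rw [covDeriv, T.deriv_horizontal_line, T.deriv_vertical_line hA hv,
          nabla.derivationTerm_christoffelMap]
        rfl
    _ = Tensor.ofChart p p (T.coordDeriv p z (e u, 0) - T.coordDeriv p z (0, Γ (e v)) -
          (T.coord p z).derivationTerm Γ) := by
        simp only [Tensor.ofChart, Tensor.pull_sub, Γ, z, e, nabla.christoffelCoord_self hv u v]
    _ = Tensor.ofChart p p (nabla.covDerivCoord T p ((extChartAt 𝓘(ℝ, E) p p, e u), e v)) := by
        rw [← hsplit, sub_eq_add_neg, ← Tensor.derivationTerm_neg]
        rfl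

end AnisotropicConnection

end CovDeriv

end

theorem mainTheorem4_general
    {E : Type*} [NormedAddCommGroup E] [NormedSpace ℝ E] [FiniteDimensional ℝ E]
    {M : Type*} [TopologicalSpace M] [T2Space M] [ChartedSpace E M] [IsManifold 𝓘(ℝ, E) ∞ M]
    {A : Set (TangentBundle 𝓘(ℝ, E) M)} (hA_open : IsOpen A)
    {r s : ℕ} (T : AnisotropicTensor A r s) (nabla : AnisotropicConnection A)
    {γ : ℝ → M} {a b : ℝ} (hab : a < b)
    (hγ : ContMDiffOn 𝓘(ℝ) 𝓘(ℝ, E) ∞ γ (Set.Icc a b))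
    (v : TangentSpace 𝓘(ℝ, E) (γ a)) (hv : (⟨γ a, v⟩ : TangentBundle 𝓘(ℝ, E) M) ∈ A) :
    HasDerivWithinAt (fun t => nabla.tensorTransport T γ a b t a v)
      (nabla.covDeriv T v hv (AnisotropicConnection.velocity E γ a b a)) (Set.Icc a b) a := by
  have hp := mem_chart_source E (γ a)
  obtain ⟨β, Φ, hΦ⟩ := nabla.exists_isParallelFrame hA_open hab hγ (coordOf_mem_coordDom hv hp)
  let y := (tangentTriv E (γ a)).continuousLinearMapAt ℝ (γ a) v
  have ha : a ∈ Ico a β := left_mem_Ico.2 hΦ.mem_Ioc.1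
  have hv₀ : v = AnisotropicConnection.coordField γ a (Φ · y) a := by
    refine hΦ.eq_coordField (Ico_subset_Icc_self ha) ?_
    rw [hΦ.initial, one_apply_eq_self, tangentTriv_apply_snd hp]
  have htransport : (fun t => nabla.tensorTransport T γ a b t a v) =ᶠ[𝓝[Icc a b] a]
      fun t => Tensor.ofChart (γ a) (γ a)
        ((T.coord (γ a) (extChartAt 𝓘(ℝ, E) (γ a) (γ t), Φ t y)).pull (Φ t)
          (Ring.inverse (Φ t))) := by
    filter_upwards [AnisotropicConnection.IsParallelFrame.Ico_mem_nhdsWithin ha] with t ht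
    rw [← hΦ.tensorTransport_eq hA_open hγ T ht, ← hv₀]
  rw [nabla.covDeriv_eq_ofChart hA_open]
  refine HasFDerivWithinAt.congr_of_eventuallyEq ?_ htransport
    (htransport.eq_of_nhdsWithin (left_mem_Icc.2 hab.le))
  exact Tensor.hasDerivAtFilter_ofChart _ _ (hΦ.hasDerivWithinAt_coord_pull hA_open hγ T)

theorem mainTheorem4 {E : Type*} [NormedAddCommGroup E] [NormedSpace ℝ E] [FiniteDimensional ℝ E]
    {M : Type*} [TopologicalSpace M] [T2Space M] [ChartedSpace E M] [IsManifold 𝓘(ℝ, E) ∞ M]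
    (A : Set (TangentBundle 𝓘(ℝ, E) M)) (hA_open : IsOpen A)
    (hA_conic : ∀ v ∈ A, ∀ c : ℝ, 0 < c → (⟨v.proj, c • v.2⟩ : TangentBundle 𝓘(ℝ, E) M) ∈ A)
    (hA_proj : ∀ p : M, ∃ v ∈ A, v.proj = p)
    {r s : ℕ} (T : AnisotropicTensor A r s) (nabla : AnisotropicConnection A)
    (γ : ℝ → M) (a b : ℝ) (hab : a < b)
    (hγ : ContMDiffOn 𝓘(ℝ) 𝓘(ℝ, E) ∞ γ (Set.Icc a b))
    (hγ_regular : ∀ t ∈ Set.Icc a b, AnisotropicConnection.velocity E γ a b t ≠ 0)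
    (v : TangentSpace 𝓘(ℝ, E) (γ a)) (hv : (⟨γ a, v⟩ : TangentBundle 𝓘(ℝ, E) M) ∈ A) :
    HasDerivWithinAt (fun t => nabla.tensorTransport T γ a b t a v)
      (nabla.covDeriv T v hv (AnisotropicConnection.velocity E γ a b a)) (Set.Icc a b) a :=
  mainTheorem4_general hA_open T nabla hab hγ v hv
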